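/- Let $\alpha,\beta,\kappa\in\mathbb R$, let $\theta\in[0,2\pi)$ denote spatial frequency, and put $\sigma_\theta=\alpha(1+2\kappa\cos\theta)$. Consider the spatially invariant plant $$x^1_{k,t+1}=\beta x^1_{k,t}+x^2_{k,t},\qquad x^2_{k,t+1}=\alpha\big(x^2_{k,t}+\kappa(x^2_{k-1,t}+x^2_{k+1,t})\big)+w^u_{k,t}+u_{k,t},$$ $$\zeta_{k,t}=(x^1_{k,t},x^2_{k,t},u_{k,t}),\qquad y_{k,t}=x^1_{k,t}+w^y_{k,t}\qquad(k\in\mathbb Z),$$ with spatially invariant controllers $u=Ky$, given by a rational function $K_\theta(z)$ for each $\theta$. For a well-posed loop let $\Gamma,\Lambda,\Psi,\Omega$ be the closed-loop maps defined by $\begin{bmatrix}y\\u+w^u\end{bmatrix}=\begin{bmatrix}\Gamma&\Lambda\\\Psi&\Omega\end{bmatrix}\begin{bmatrix}w^y\\w^u\end{bmatrix}$, and let $\mathcal F(P,K)$ be the closed-loop map from $w=(w^y,w^u)$ to $\zeta$. $\mathcal{RH}_\infty$ is the set of proper rational functions of $z$ with all poles in the open unit disk. $K$ is internally stabilizing if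 for every $\theta$ the loop is well posed and $\Gamma_\theta,\Lambda_\theta,\Psi_\theta,\Omega_\theta\in\mathcal{RH}_\infty$. A scalar map $G$ has extent $E$ ($\mathrm{ext}(G)\le E$) if $G_\theta=\sum_{|k|\le E}g_ke^{-ik\theta}$ with real rational $g_k$. The squared $\mathcal H_2$ norm of $G$ is $\frac1{4\pi^2}\int_0^{2\pi}\!\int_{|z|=1}\mathrm{trace}(G_{\theta,z}^\dagger G_{\theta,z})\,|dz|\,d\theta$, and that of a finite column $v$ of transfer functions in the spatial index domain is $\frac1{2\pi}\int_{|z|=1}\sum_k|v_k(z)|^2\,|dz|$. Consider the problem $$(\ast)\qquad \inf_K\ \|\mathcal F(P,K)\|_2\quad\text{s.t. } K\text{ internally stabilizing and } \mathrm{ext}(\Gamma),\mathrm{ext}(\Lambda),\mathrm{ext}(\Psi),\mathrm{ext}(\Omega)<\infty.$$ For $E\in\mathbb N$ and a real rational column $f=(f_k)_{|k|\le E}\in\mathcal{RH}_\infty^{(2E+1)\times1}$ put $f_\theta=\sum_{|k|\le E}f_ke^{-ik\theta}$ and $$\lambda_\theta(f)=z^{-2}+z^{-3}(\sigma_\theta+\beta)+z^{-4}f_\theta,\quad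 \gamma_\theta(f)=(z-\beta)(z-\sigma_\theta)\lambda_\theta(f),\quad \psi_\theta(f)=(z-\beta)^2(z-\sigma_\theta)^2\lambda_\theta(f)-(z-\beta)(z-\sigma_\theta),$$ and $K(f)=\psi(f)\gamma(f)^{-1}$. Let $V^{\rm IO},h^{\rm IO}$ be the matrix and column of transfer functions such that $V^{\rm IO}f+h^{\rm IO}$ stacks the index-domain coefficients of $\gamma(f)-1$ (indices $|k|\le E+2$), $\lambda(f)$ ($|k|\le E+1$), $(z-\beta)(\gamma(f)-1)$ ($|k|\le E+2$), $(z-\beta)\lambda(f)$ ($|k|\le E+1$), $\psi(f)$ ($|k|\le E+3$) and $\gamma(f)-1$ ($|k|\le E+2$); explicitly $V^{\rm IO}=WS$ and $h^{\rm IO}=Wg+h$, where $S=z^{-4}[0;I_{2E+1};0]$, $g$ is the column of $z^{-2}+z^{-3}(\sigma+\beta)$, $W$ stacks the banded Toeplitz matrices of multiplication by $(z-\beta)(z-\sigma)$, $1$, $(z-\beta)^2(z-\sigma)$, $z-\beta$, $(z-\beta)^2(z-\sigma)^2$, $(z-\beta)(z-\sigma)$, and $h$ stacks the columns of $-1$,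 $0$, $-(z-\beta)$, $0$, $-(z-\beta)(z-\sigma)$, $-1$. Theorem. 1. For every internally stabilizing $K$, $$\mathcal F(P,K)=\begin{bmatrix}\Gamma-1&\Lambda\\(z-\beta)(\Gamma-1)&(z-\beta)\Lambda\\\Psi&\Omega-1\end{bmatrix};$$ in particular $x^2=(z-\beta)\big((\Gamma-1)w^y+\Lambda w^u\big)$. 2. For every $E\in\mathbb N$ let $\mathcal K_E$ be the set of controllers feasible for $(\ast)$ whose parameter $z^4\Lambda_\theta-z^2-z(\sigma_\theta+\beta)$ has extent $E$. Then $f\mapsto K(f)$ is a bijection from $\mathcal{RH}_\infty^{(2E+1)\times1}$ (that is, $2E+1$ scalar decision variables) onto $\mathcal K_E$. For every such $f$ the controller $K(f)$ has $\Lambda=\lambda(f)$, $\mathrm{ext}(\Gamma),\mathrm{ext}(\Omega)\le\max\{E+1,2\}$, $\mathrm{ext}(\Lambda)\le\max\{E,1\}$, $\mathrm{ext}(\Psi)\le\max\{E+2,3\}$, and $\|\mathcal F(P,K(f))\|_2^2=\|V^{\rm IO}f+h^{\rm IO}\|_2^2<\infty$. If $E\ge1$, then $\mathcal K_E$ is exactly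 the set of internally stabilizing controllers that satisfy these four extent bounds. Consequently $$\Big(\inf_{K\in\mathcal K_E}\|\mathcal F(P,K)\|_2\Big)^2=\inf_{f\in\mathcal{RH}_\infty^{(2E+1)\times1}}\|V^{\rm IO}f+h^{\rm IO}\|_2^2,$$ $K(f)$ is optimal for the left-hand problem if and only if $f$ is optimal for the right-hand one, and the right-hand objective is convex in $f$. 3. The feasible set of $(\ast)$ is $\bigcup_{E\in\mathbb N}\{K(f): f\in\mathcal{RH}_\infty^{(2E+1)\times1}\}$, and the square of the value of $(\ast)$ is $\inf_{E\in\mathbb N}\inf_{f\in\mathcal{RH}_\infty^{(2E+1)\times 1}}\|V^{\rm IO}f+h^{\rm IO}\|_2^2$. -/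

import Mathlib

open MeasureTheory

namespace IOSynthesis

noncomputable section

/-! ### Transfer functions -/

/-- A rational transfer function in `z` (the variable `RatFunc.X`) with coefficients in a field `F`
(used for `F = ℝ` and `F = ℂ`) belongs to `RH∞`: it is causal (proper), and stable, i.e. all its
poles lie in the open unit disk. `num` and `denom` are coprime, so the poles are the complex roots
of `denom`. -/
def IsRHInf {F : Type*} [Field F] [Algebra F ℂ] (g : RatFunc F) : Prop :=
  g.num.natDegree ≤ g.denom.natDegree ∧
    ∀ p : ℂ, Polynomial.aeval p g.denom = 0 → ‖p‖ < 1

/-- A real rational function regarded as a complex one. -/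
def complexify : RatFunc ℝ →+* RatFunc ℂ :=
  RatFunc.mapRingHom (Polynomial.mapRingHom (algebraMap ℝ ℂ)) fun p hp => by
    rw [Submonoid.mem_comap, mem_nonZeroDivisors_iff_ne_zero]
    rw [mem_nonZeroDivisors_iff_ne_zero] at hp
    exact (Polynomial.map_ne_zero_iff (algebraMap ℝ ℂ).injective).2 hp

/-- Spatial frequencies `θ ∈ [0, 2π)`. -/
abbrev Freq : Type := Set.Ico (0 : ℝ) (2 * Real.pi)

/-- The spatial indices `-E, …, E`. -/
abbrev Site (E : ℕ) : Type := Finset.Icc (-(E : ℤ)) (E : ℤ)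

/-- Spatial Fourier transform `θ ↦ ∑_{|k| ≤ E} g_k e^{-ikθ}` of the scalar index-domain map whose
`k`-th component is `g_k` for `|k| ≤ E` and `0` for `|k| > E`. -/
def spatialTransform {E : ℕ} (g : Site E → RatFunc ℝ) (θ : Freq) : RatFunc ℂ :=
  ∑ k : Site E,
    RatFunc.C (Complex.exp (-(Complex.I * ((k : ℤ) : ℂ) * ((θ : ℝ) : ℂ)))) * complexify (g k)

/-- A scalar spatially invariant map, given in the spatial frequency domain, has extent (at most)
`E`: its index-domain kernel `g_k` vanishes for `|k| > E`, i.e. the Toeplitz operator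
`(g_{i-j})_{i,j}` is structured with respect to the `E`-nearest neighbors graph. -/
def HasExtent (G : Freq → RatFunc ℂ) (E : ℕ) : Prop :=
  ∃ g : Site E → RatFunc ℝ, ∀ θ, G θ = spatialTransform g θ

/-! ### The plant

In the spatial index domain:
`x¹_{k,t+1} = β x¹_{k,t} + x²_{k,t}`,
`x²_{k,t+1} = α (x²_{k,t} + κ (x²_{k-1,t} + x²_{k+1,t})) + wᵘ_{k,t} + u_{k,t}`,
`ζ_{k,t} = (x¹_{k,t}, x²_{k,t}, u_{k,t})`, `y_{k,t} = x¹_{k,t} + wʸ_{k,t}`.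
Below it is written at a spatial frequency `θ`, with disturbance `w = (wʸ, wᵘ)`. -/

/-- `σ_θ = α (1 + 2 κ cos θ)`. -/
def sigma (α κ : ℝ) (θ : Freq) : ℝ := α * (1 + 2 * κ * Real.cos θ)

def matA (α β κ : ℝ) (θ : Freq) : Matrix (Fin 2) (Fin 2) ℂ := !![(β : ℂ), 1; 0, (sigma α κ θ : ℂ)]

def matB1 : Matrix (Fin 2) (Fin 2) ℂ := !![0, 0; 0, 1]

def matB2 : Matrix (Fin 2) (Fin 1) ℂ := !![0; 1]

def matC1 : Matrix (Fin 3) (Fin 2) ℂ := !![1, 0; 0, 1; 0, 0]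

def matD12 : Matrix (Fin 3) (Fin 1) ℂ := !![0; 0; 1]

def matC2 : Matrix (Fin 1) (Fin 2) ℂ := !![1, 0]

def matD21 : Matrix (Fin 1) (Fin 2) ℂ := !![1, 0]

/-- `(zI - A_θ)⁻¹`. -/
def plantResolvent (α β κ : ℝ) (θ : Freq) : Matrix (Fin 2) (Fin 2) (RatFunc ℂ) :=
  ((RatFunc.X : RatFunc ℂ) • (1 : Matrix (Fin 2) (Fin 2) (RatFunc ℂ))
    - (matA α β κ θ).map RatFunc.C)⁻¹

/-- `P^{ζw} = C¹ (zI - A)⁻¹ B¹`. -/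
def plantZW (α β κ : ℝ) (θ : Freq) : Matrix (Fin 3) (Fin 2) (RatFunc ℂ) :=
  matC1.map RatFunc.C * plantResolvent α β κ θ * matB1.map RatFunc.C

/-- `P^{ζu} = C¹ (zI - A)⁻¹ B² + D¹²`. -/
def plantZU (α β κ : ℝ) (θ : Freq) : Matrix (Fin 3) (Fin 1) (RatFunc ℂ) :=
  matC1.map RatFunc.C * plantResolvent α β κ θ * matB2.map RatFunc.C + matD12.map RatFunc.C

/-- `P^{yw} = C² (zI - A)⁻¹ B¹ + D²¹`. -/
def plantYW (α β κ : ℝ) (θ : Freq) : Matrix (Fin 1) (Fin 2) (RatFunc ℂ) :=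
  matC2.map RatFunc.C * plantResolvent α β κ θ * matB1.map RatFunc.C + matD21.map RatFunc.C

/-- `P^{yu} = C² (zI - A)⁻¹ B²`, a scalar. -/
def plantYU (α β κ : ℝ) (θ : Freq) : RatFunc ℂ :=
  (matC2.map RatFunc.C * plantResolvent α β κ θ * matB2.map RatFunc.C) 0 0

/-! ### Closed loop -/

/-- A spatially invariant controller `u = K y`: one rational function for every frequency. -/
abbrev Controller : Type := Freq → RatFunc ℂ

/-- The loop equations `y - P^{yu} v = wʸ`, `v - K y = wᵘ` in the unknowns `y` and `v = u + wᵘ`. -/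
def loopMatrix (α β κ : ℝ) (K : Controller) (θ : Freq) : Matrix (Fin 2) (Fin 2) (RatFunc ℂ) :=
  !![1, -plantYU α β κ θ; -K θ, 1]

/-- The closed-loop map `[Γ, Λ; Ψ, Ω]` from `(wʸ, wᵘ)` to `(y, u + wᵘ)`. -/
def ioMaps (α β κ : ℝ) (K : Controller) (θ : Freq) : Matrix (Fin 2) (Fin 2) (RatFunc ℂ) :=
  (loopMatrix α β κ K θ)⁻¹

def Gam (α β κ : ℝ) (K : Controller) (θ : Freq) : RatFunc ℂ := ioMaps α β κ K θ 0 0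

def Lam (α β κ : ℝ) (K : Controller) (θ : Freq) : RatFunc ℂ := ioMaps α β κ K θ 0 1

def Psi (α β κ : ℝ) (K : Controller) (θ : Freq) : RatFunc ℂ := ioMaps α β κ K θ 1 0

def Ome (α β κ : ℝ) (K : Controller) (θ : Freq) : RatFunc ℂ := ioMaps α β κ K θ 1 1

/-- `C_stab`: at every frequency the loop is well posed and all four closed-loop maps are in
`RH∞`. -/
def InternallyStabilizing (α β κ : ℝ) (K : Controller) : Prop :=
  ∀ θ, (loopMatrix α β κ K θ).det ≠ 0 ∧
    IsRHInf (Gam α β κ K θ) ∧ IsRHInf (Lam α β κ K θ) ∧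
    IsRHInf (Psi α β κ K θ) ∧ IsRHInf (Ome α β κ K θ)

/-- `F(P, K) = P^{ζw} + P^{ζu} K (1 - P^{yu} K)⁻¹ P^{yw}`, the closed-loop map from
`w = (wʸ, wᵘ)` to `ζ = (x¹, x², u)`. -/
def closedLoop (α β κ : ℝ) (K : Controller) (θ : Freq) : Matrix (Fin 3) (Fin 2) (RatFunc ℂ) :=
  plantZW α β κ θ +
    (K θ * (1 - plantYU α β κ θ * K θ)⁻¹) • (plantZU α β κ θ * plantYW α β κ θ)

/-- The squared `H₂` norm
`(1 / 4π²) ∫_θ ∫_{|z| = 1} trace (G_{θ,z}† G_{θ,z})` of a map in the spatio-temporal frequency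
domain, with `z = e^{iφ}` and Lebesgue measure in `θ` and `φ`. -/
def h2NormSqFreq {m n : Type*} [Fintype m] [Fintype n] (G : Freq → Matrix m n (RatFunc ℂ)) :
    ENNReal :=
  ENNReal.ofReal (1 / (4 * Real.pi ^ 2)) *
    ∫⁻ θ : Freq, (∫⁻ φ in Set.Ico (0 : ℝ) (2 * Real.pi),
      ∑ i, ∑ j, ‖RatFunc.eval (RingHom.id ℂ) (Complex.exp (Complex.I * φ)) (G θ i j)‖ₑ ^ 2)
      ∂(Measure.comap Subtype.val volume)

/-- The squared `H₂` norm `(1 / 2π) ∫_{|z| = 1} ∑_k |v_k(z)|²` of a finite vector of transfer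
functions in the spatial index domain. -/
def h2NormSqIndex {m : Type*} [Fintype m] (v : m → RatFunc ℝ) : ENNReal :=
  ENNReal.ofReal (1 / (2 * Real.pi)) *
    ∫⁻ φ in Set.Ico (0 : ℝ) (2 * Real.pi),
      ∑ k, ‖RatFunc.eval (algebraMap ℝ ℂ) (Complex.exp (Complex.I * φ)) (v k)‖ₑ ^ 2

/-- The cost `‖F(P, K)‖₂` of the optimal control problem. -/
def cost (α β κ : ℝ) (K : Controller) : ENNReal :=
  h2NormSqFreq (closedLoop α β κ K) ^ (1 / 2 : ℝ)

/-! ### Feasible sets -/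

/-- Internally stabilizing controllers for which `Γ, Λ, Ψ, Ω` have finite extent. -/
def feasible (α β κ : ℝ) : Set Controller :=
  {K | InternallyStabilizing α β κ K ∧
    (∃ E, HasExtent (Gam α β κ K) E) ∧ (∃ E, HasExtent (Lam α β κ K) E) ∧
    (∃ E, HasExtent (Psi α β κ K) E) ∧ (∃ E, HasExtent (Ome α β κ K) E)}

/-- Internally stabilizing controllers for which `Γ` and `Ω` have extent `max (E+1) 2`, `Λ` has
extent `max E 1` and `Ψ` has extent `max (E+2) 3`. -/
def feasibleBounded (α β κ : ℝ) (E : ℕ) : Set Controller :=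
  {K | InternallyStabilizing α β κ K ∧
    HasExtent (Gam α β κ K) (max (E + 1) 2) ∧ HasExtent (Lam α β κ K) (max E 1) ∧
    HasExtent (Psi α β κ K) (max (E + 2) 3) ∧ HasExtent (Ome α β κ K) (max (E + 1) 2)}

/-- The parameter `f_θ` of a controller, i.e. the solution of
`Λ_θ = z⁻² + z⁻³ (σ_θ + β) + z⁻⁴ f_θ`. -/
def parameter (α β κ : ℝ) (K : Controller) (θ : Freq) : RatFunc ℂ :=
  RatFunc.X ^ 4 * Lam α β κ K θ - RatFunc.X ^ 2
    - RatFunc.X * RatFunc.C ((sigma α κ θ + β : ℝ) : ℂ)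

/-! ### The unconstrained problem -/

/-- `RH∞^{(2E+1) × 1}`. -/
def RHInfVec (E : ℕ) : Set (Site E → RatFunc ℝ) := {f | ∀ k, IsRHInf (f k)}

/-- `λ_θ(f) = z⁻² + z⁻³ (σ_θ + β) + z⁻⁴ f_θ`. -/
def lamOf (α β κ : ℝ) {E : ℕ} (f : Site E → RatFunc ℝ) (θ : Freq) : RatFunc ℂ :=
  (RatFunc.X ^ 2)⁻¹ + (RatFunc.X ^ 3)⁻¹ * RatFunc.C ((sigma α κ θ + β : ℝ) : ℂ)
    + (RatFunc.X ^ 4)⁻¹ * spatialTransform f θ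

/-- `(z - β)(z - σ_θ)`. -/
def charPoly (α β κ : ℝ) (θ : Freq) : RatFunc ℂ :=
  (RatFunc.X - RatFunc.C (β : ℂ)) * (RatFunc.X - RatFunc.C (sigma α κ θ : ℂ))

/-- `γ_θ(f) = ω_θ(f) = (z - β)(z - σ_θ) λ_θ(f)`. -/
def gamOf (α β κ : ℝ) {E : ℕ} (f : Site E → RatFunc ℝ) (θ : Freq) : RatFunc ℂ :=
  charPoly α β κ θ * lamOf α β κ f θ

/-- `ψ_θ(f) = (z - β)² (z - σ_θ)² λ_θ(f) - (z - β)(z - σ_θ)`. -/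
def psiOf (α β κ : ℝ) {E : ℕ} (f : Site E → RatFunc ℝ) (θ : Freq) : RatFunc ℂ :=
  charPoly α β κ θ ^ 2 * lamOf α β κ f θ - charPoly α β κ θ

/-- The controller `K = Ψ(f) Γ(f)⁻¹`. -/
def controllerOf (α β κ : ℝ) {E : ℕ} (f : Site E → RatFunc ℝ) : Controller :=
  fun θ => psiOf α β κ f θ * (gamOf α β κ f θ)⁻¹

/-- `z - c` for a real constant `c`. -/
def zSub (c : ℝ) : RatFunc ℝ := RatFunc.X - RatFunc.C c

/-- The Toeplitz matrix `V^γ = V^ω` of multiplication by `(z - β)(z - σ)`. -/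
def matVGam (α β κ : ℝ) (E : ℕ) : Matrix (Site (E + 2)) (Site (E + 1)) (RatFunc ℝ) :=
  Matrix.of fun i j => zSub β *
    (if |(i : ℤ) - (j : ℤ)| = 0 then zSub α
    else if |(i : ℤ) - (j : ℤ)| = 1 then RatFunc.C (-(α * κ))
    else 0)

/-- The Toeplitz matrix `V^ψ` of multiplication by `(z - β)² (z - σ)²`. -/
def matVPsi (α β κ : ℝ) (E : ℕ) : Matrix (Site (E + 3)) (Site (E + 1)) (RatFunc ℝ) :=
  Matrix.of fun i j => zSub β ^ 2 *
    (if |(i : ℤ) - (j : ℤ)| = 0 then zSub α ^ 2 + RatFunc.C (2 * (α * κ) ^ 2)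
    else if |(i : ℤ) - (j : ℤ)| = 1 then RatFunc.C (-(2 * (α * κ))) * zSub α
    else if |(i : ℤ) - (j : ℤ)| = 2 then RatFunc.C ((α * κ) ^ 2)
    else 0)

/-- The column `-δ_k` of the constant terms of `γ - 1` and `ω - 1`. -/
def vecHGam (E : ℕ) : Site (E + 2) → RatFunc ℝ := fun k => if (k : ℤ) = 0 then -1 else 0

/-- The column `h^ψ` of `-(z - β)(z - σ)`. -/
def vecHPsi (α β κ : ℝ) (E : ℕ) : Site (E + 3) → RatFunc ℝ := fun k => zSub β *
  (if |(k : ℤ)| = 0 then -zSub α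
  else if |(k : ℤ)| = 1 then RatFunc.C (α * κ)
  else 0)

/-- `S = z⁻⁴ [0; I; 0]`. -/
def matS (E : ℕ) : Matrix (Site (E + 1)) (Site E) (RatFunc ℝ) :=
  Matrix.of fun i j => if (i : ℤ) = (j : ℤ) then (RatFunc.X ^ 4)⁻¹ else 0

/-- `g`, the column of `z⁻² + z⁻³ (σ + β)`. -/
def vecG (α β κ : ℝ) (E : ℕ) : Site (E + 1) → RatFunc ℝ := fun k => (RatFunc.X ^ 3)⁻¹ *
  (if |(k : ℤ)| = 0 then RatFunc.X + RatFunc.C (α + β)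
  else if |(k : ℤ)| = 1 then RatFunc.C (α * κ)
  else 0)

/-- Row labels of the stacked column
`γ - 1, λ, (z - β)(γ - 1), (z - β) λ, ψ, ω - 1`. -/
abbrev Rows (E : ℕ) : Type :=
  Site (E + 2) ⊕ Site (E + 1) ⊕ Site (E + 2) ⊕ Site (E + 1) ⊕ Site (E + 3) ⊕ Site (E + 2)

/-- The stacked linear parts, acting on the column of `λ`. -/
def matStack (α β κ : ℝ) (E : ℕ) : Matrix (Rows E) (Site (E + 1)) (RatFunc ℝ) :=
  Matrix.fromRows (matVGam α β κ E) <|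
  Matrix.fromRows 1 <|
  Matrix.fromRows (zSub β • matVGam α β κ E) <|
  Matrix.fromRows (zSub β • (1 : Matrix (Site (E + 1)) (Site (E + 1)) (RatFunc ℝ))) <|
  Matrix.fromRows (matVPsi α β κ E) (matVGam α β κ E)

/-- The stacked constant parts. -/
def vecStack (α β κ : ℝ) (E : ℕ) : Rows E → RatFunc ℝ :=
  Sum.elim (vecHGam E) <| Sum.elim 0 <| Sum.elim (zSub β • vecHGam E) <| Sum.elim 0 <|
    Sum.elim (vecHPsi α β κ E) (vecHGam E)

/-- `V^{IO}`. -/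
def matVIO (α β κ : ℝ) (E : ℕ) : Matrix (Rows E) (Site E) (RatFunc ℝ) :=
  matStack α β κ E * matS E

/-- `h^{IO}`. -/
def vecHIO (α β κ : ℝ) (E : ℕ) : Rows E → RatFunc ℝ :=
  (matStack α β κ E).mulVec (vecG α β κ E) + vecStack α β κ E

/-- The objective `‖V^{IO} f + h^{IO}‖₂²`. -/
def objective (α β κ : ℝ) (E : ℕ) (f : Site E → RatFunc ℝ) : ENNReal :=
  h2NormSqIndex ((matVIO α β κ E).mulVec f + vecHIO α β κ E)

end

end IOSynthesis

/-! Write c = (z-β)(z-σ_θ) and s = σ_θ+β. The plant from u to y is the scalar 1/c, so in a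
well-posed loop Γ = Ω = cΛ and Ψ = c²Λ - c. The single map Λ determines all the others, and K =
ΨΓ⁻¹; the formula for the closed loop (`closedLoop_eq`) comes from the same algebra.

Internal stability fixes the behaviour of Λ at infinity. Since Ψ is proper, Λ = c⁻¹ + c⁻²Ψ = z⁻² + s
z⁻³ + O(z⁻⁴), so f = z⁴Λ - z² - sz is proper; it has no finite poles besides those of Λ, hence lies
in RH∞ (`isRHInf_parameter`). Conversely, for f in RH∞ the function γ - 1 = cλ(f) - 1 has degree at
most -2 (`degLE_gamOf_sub_one`). Hence γ ≠ 0, the loop is well posed, ψ = c(γ-1) is proper, and the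
only poles added are at 0.

The polynomial c has extent 1, so a bound on the extent of Λ gives bounds for f and for the other
maps. A kernel of extent E is a finite linear combination of 2E+1 frequency samples
(`complexify_eq_sum`): the coefficients of f are therefore unique and inherit stability from f_θ.
This gives the bijection `bijOn_controllerOf`.

For the cost, banded Toeplitz matrices are multiplications in the frequency domain
(`seqTransform_convolution`), and Parseval in θ replaces each closed-loop entry by the squares of
its index-domain coefficients (`h2NormSqFreq_eq`). The squared cost is thus the squared norm of an
affine function of f, hence convex, and infima and minimizers are carried along the bijection. -/

namespace IOSynthesis

noncomputable section

/-! ### Stable and proper rational functions -/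

section Degree

variable {F : Type} [Field F]

/-- A rational function of degree at most `n`, with `0` of degree `-∞`. -/
def DegLE (g : RatFunc F) (n : ℤ) : Prop := g ≠ 0 → g.intDegree ≤ n

theorem DegLE.mono {g : RatFunc F} {m n : ℤ} (h : DegLE g m) (hmn : m ≤ n) : DegLE g n :=
  fun hg => (h hg).trans hmn

theorem degLE_zero (n : ℤ) : DegLE (0 : RatFunc F) n := fun h => absurd rfl h

theorem DegLE.add {a b : RatFunc F} {n : ℤ} (ha : DegLE a n) (hb : DegLE b n) :
    DegLE (a + b) n := fun hab => by
  by_cases ha0 : a = 0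
  · subst ha0
    rw [zero_add] at hab ⊢
    exact hb hab
  by_cases hb0 : b = 0
  · subst hb0
    rw [add_zero] at hab ⊢
    exact ha hab
  exact (RatFunc.intDegree_add_le hb0 hab).trans (max_le (ha ha0) (hb hb0))

theorem DegLE.neg {a : RatFunc F} {n : ℤ} (ha : DegLE a n) : DegLE (-a) n := fun h => by
  rw [RatFunc.intDegree_neg]
  exact ha (neg_ne_zero.1 h)

theorem DegLE.sub {a b : RatFunc F} {n : ℤ} (ha : DegLE a n) (hb : DegLE b n) :
    DegLE (a - b) n := sub_eq_add_neg a b ▸ ha.add hb.neg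

theorem DegLE.mul {a b : RatFunc F} {m n : ℤ} (ha : DegLE a m) (hb : DegLE b n) :
    DegLE (a * b) (m + n) := fun hab => by
  have h := mul_ne_zero_iff.1 hab
  rw [RatFunc.intDegree_mul h.1 h.2]
  exact add_le_add (ha h.1) (hb h.2)

theorem degLE_C (c : F) : DegLE (RatFunc.C c) 0 := fun _ => by simp

theorem degLE_one : DegLE (1 : RatFunc F) 0 := fun _ => by simp

theorem degLE_X : DegLE (RatFunc.X : RatFunc F) 1 := fun _ => by simp

theorem intDegree_X_pow (n : ℕ) : ((RatFunc.X : RatFunc F) ^ n).intDegree = n := by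
  rw [← RatFunc.algebraMap_X, ← map_pow, RatFunc.intDegree_polynomial]
  simp

theorem degLE_X_pow (n : ℕ) : DegLE ((RatFunc.X : RatFunc F) ^ n) n := fun _ =>
  (intDegree_X_pow n).le

theorem degLE_inv_X_pow (n : ℕ) : DegLE ((RatFunc.X : RatFunc F) ^ n)⁻¹ (-n) := fun _ => by
  rw [RatFunc.intDegree_inv, intDegree_X_pow]

end Degree

section RationalFunctions

variable {F : Type} [Field F] [Algebra F ℂ]

/-- The rational functions with all poles in the open unit disk. -/
def stableSubring (F : Type) [Field F] [Algebra F ℂ] : Subring (RatFunc F) where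
  carrier := {g | ∀ p : ℂ, Polynomial.aeval p g.denom = 0 → ‖p‖ < 1}
  zero_mem' := fun p hp => by simp at hp
  one_mem' := fun p hp => by simp at hp
  neg_mem' := fun {g} hg p hp => hg p <| by
    have hd : (-g).denom ∣ g.denom :=
      (RatFunc.denom_dvd g.denom_ne_zero).2
        ⟨-g.num, by rw [map_neg, neg_div, RatFunc.num_div_denom]⟩
    exact zero_dvd_iff.1 (hp ▸ map_dvd (Polynomial.aeval p) hd)
  add_mem' := fun {a b} ha hb p hp => by
    have h := zero_dvd_iff.1 (hp ▸ map_dvd (Polynomial.aeval p) (RatFunc.denom_add_dvd a b))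
    rw [map_mul, mul_eq_zero] at h
    exact h.elim (ha p) (hb p)
  mul_mem' := fun {a b} ha hb p hp => by
    have h := zero_dvd_iff.1 (hp ▸ map_dvd (Polynomial.aeval p) (RatFunc.denom_mul_dvd a b))
    rw [map_mul, mul_eq_zero] at h
    exact h.elim (ha p) (hb p)

theorem C_mem_stableSubring (c : F) : RatFunc.C c ∈ stableSubring F := fun p hp => by
  simp at hp

theorem X_mem_stableSubring : (RatFunc.X : RatFunc F) ∈ stableSubring F := fun p hp => by
  simp at hp

/-- The only pole is 0, which is inside the disk; this makes the delays in `lamOf` harmless. -/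
theorem inv_X_mem_stableSubring : (RatFunc.X : RatFunc F)⁻¹ ∈ stableSubring F := fun p hp => by
  have hd := RatFunc.denom_inv_dvd (RatFunc.X_ne_zero (K := F))
  have h := zero_dvd_iff.1 (hp ▸ map_dvd (Polynomial.aeval p) hd)
  simp at h
  simp [h]

theorem inv_X_pow_mem_stableSubring (n : ℕ) :
    ((RatFunc.X : RatFunc F) ^ n)⁻¹ ∈ stableSubring F := by
  rw [← inv_pow]
  exact pow_mem inv_X_mem_stableSubring n

/-- Properness and stability are tracked separately, because improper factors such as z - β are
stable and occur inside products that are proper only as a whole. -/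
theorem isRHInf_iff {g : RatFunc F} : IsRHInf g ↔ DegLE g 0 ∧ g ∈ stableSubring F := by
  refine and_congr ⟨fun h _ => ?_, fun h => ?_⟩ Iff.rfl
  · rw [RatFunc.intDegree]
    lia
  · by_cases hg : g = 0
    · simp [hg]
    · have := h hg
      rw [RatFunc.intDegree] at this
      lia

theorem IsRHInf.mem {g : RatFunc F} (h : IsRHInf g) : g ∈ stableSubring F := h.2

theorem IsRHInf.degLE {g : RatFunc F} (h : IsRHInf g) : DegLE g 0 := (isRHInf_iff.1 h).1

theorem IsRHInf.add {a b : RatFunc F} (ha : IsRHInf a) (hb : IsRHInf b) : IsRHInf (a + b) :=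
  isRHInf_iff.2 ⟨ha.degLE.add hb.degLE, add_mem ha.mem hb.mem⟩

theorem IsRHInf.C_mul {a : RatFunc F} (ha : IsRHInf a) (c : F) : IsRHInf (RatFunc.C c * a) :=
  isRHInf_iff.2 ⟨(degLE_C c).mul ha.degLE, mul_mem (C_mem_stableSubring c) ha.mem⟩

theorem isRHInf_zero : IsRHInf (0 : RatFunc F) := isRHInf_iff.2 ⟨degLE_zero 0, zero_mem _⟩

theorem isRHInf_sum {ι : Type*} (s : Finset ι) (a : ι → RatFunc F)
    (h : ∀ i ∈ s, IsRHInf (a i)) : IsRHInf (∑ i ∈ s, a i) :=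
  Finset.sum_induction _ IsRHInf (fun _ _ => IsRHInf.add) isRHInf_zero h

/-! ### Evaluation on the unit circle -/

theorem eval₂_denom_ne_zero_of_mem {g : RatFunc F} (hg : g ∈ stableSubring F) {z : ℂ}
    (hz : ‖z‖ = 1) : Polynomial.eval₂ (algebraMap F ℂ) z g.denom ≠ 0 := fun h =>
  (hg z h).ne hz

/-- `RatFunc.eval` is additive and multiplicative only away from poles, where division by zero does
not interfere; stable functions have no poles on the unit circle. -/
theorem eval_add_of_mem {a b : RatFunc F} (ha : a ∈ stableSubring F) (hb : b ∈ stableSubring F)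
    {z : ℂ} (hz : ‖z‖ = 1) :
    RatFunc.eval (algebraMap F ℂ) z (a + b) =
      RatFunc.eval (algebraMap F ℂ) z a + RatFunc.eval (algebraMap F ℂ) z b :=
  RatFunc.eval_add _ _ (eval₂_denom_ne_zero_of_mem ha hz) (eval₂_denom_ne_zero_of_mem hb hz)

theorem eval_mul_of_mem {a b : RatFunc F} (ha : a ∈ stableSubring F) (hb : b ∈ stableSubring F)
    {z : ℂ} (hz : ‖z‖ = 1) :
    RatFunc.eval (algebraMap F ℂ) z (a * b) =
      RatFunc.eval (algebraMap F ℂ) z a * RatFunc.eval (algebraMap F ℂ) z b :=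
  RatFunc.eval_mul _ _ (eval₂_denom_ne_zero_of_mem ha hz) (eval₂_denom_ne_zero_of_mem hb hz)

theorem eval_sum_of_mem {ι : Type*} (s : Finset ι) (a : ι → RatFunc F)
    (ha : ∀ i ∈ s, a i ∈ stableSubring F) {z : ℂ} (hz : ‖z‖ = 1) :
    RatFunc.eval (algebraMap F ℂ) z (∑ i ∈ s, a i) =
      ∑ i ∈ s, RatFunc.eval (algebraMap F ℂ) z (a i) := by
  classical
  induction s using Finset.induction_on with
  | empty => simp
  | insert i s hi ih =>
    rw [Finset.sum_insert hi, Finset.sum_insert hi, eval_add_of_mem (ha i (by simp))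
      (sum_mem fun j hj => ha j (by simp [hj])) hz, ih fun j hj => ha j (by simp [hj])]

/-- The point `e^{iφ}` of the unit circle. -/
abbrev circlePoint (φ : ℝ) : ℂ := Complex.exp (Complex.I * φ)

theorem norm_circlePoint (φ : ℝ) : ‖circlePoint φ‖ = 1 := by
  rw [circlePoint, mul_comm, Complex.norm_exp_ofReal_mul_I]

theorem continuous_eval_circlePoint {g : RatFunc F} (hg : g ∈ stableSubring F) :
    Continuous fun φ : ℝ => RatFunc.eval (algebraMap F ℂ) (circlePoint φ) g := by
  have hc (p : Polynomial F) :
      Continuous fun φ : ℝ => Polynomial.eval₂ (algebraMap F ℂ) (circlePoint φ) p := by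
    simp only [Polynomial.eval₂_eq_eval_map]
    exact (Polynomial.continuous _).comp (by fun_prop)
  exact (hc _).div (hc _) fun φ => eval₂_denom_ne_zero_of_mem hg (norm_circlePoint φ)

end RationalFunctions

/-! ### Real rational functions as complex ones -/

theorem complexify_apply (g : RatFunc ℝ) :
    complexify g = algebraMap _ (RatFunc ℂ) (g.num.map (algebraMap ℝ ℂ)) /
      algebraMap _ (RatFunc ℂ) (g.denom.map (algebraMap ℝ ℂ)) := by
  rw [complexify, RatFunc.coe_mapRingHom_eq_coe_map, RatFunc.map_apply]
  rfl

theorem denom_map_ne_zero (g : RatFunc ℝ) : g.denom.map (algebraMap ℝ ℂ) ≠ 0 :=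
  (Polynomial.map_ne_zero_iff (algebraMap ℝ ℂ).injective).2 g.denom_ne_zero

theorem complexify_algebraMap (p : Polynomial ℝ) :
    complexify (algebraMap _ (RatFunc ℝ) p) =
      algebraMap _ (RatFunc ℂ) (p.map (algebraMap ℝ ℂ)) := by
  simp [complexify_apply]

@[simp]
theorem complexify_C (c : ℝ) : complexify (RatFunc.C c) = RatFunc.C (c : ℂ) := by
  rw [← RatFunc.algebraMap_C, complexify_algebraMap, Polynomial.map_C, RatFunc.algebraMap_C]
  rfl

@[simp]
theorem complexify_X : complexify RatFunc.X = RatFunc.X := by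
  rw [← RatFunc.algebraMap_X, complexify_algebraMap, Polynomial.map_X, RatFunc.algebraMap_X]

theorem complexify_injective : Function.Injective complexify := complexify.injective

theorem intDegree_complexify (g : RatFunc ℝ) : (complexify g).intDegree = g.intDegree := by
  by_cases hg : g = 0
  · simp [hg]
  have hn : g.num.map (algebraMap ℝ ℂ) ≠ 0 :=
    (Polynomial.map_ne_zero_iff (algebraMap ℝ ℂ).injective).2 (RatFunc.num_ne_zero hg)
  rw [complexify_apply, RatFunc.intDegree_div (RatFunc.algebraMap_ne_zero hn)
    (RatFunc.algebraMap_ne_zero (denom_map_ne_zero g)), RatFunc.intDegree_polynomial,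
    RatFunc.intDegree_polynomial, Polynomial.natDegree_map, Polynomial.natDegree_map,
    RatFunc.intDegree]

/-- The cross-multiplied form avoids identifying the reduced fraction over ℂ with the image of the
reduced fraction over ℝ. -/
theorem complexify_num_mul (g : RatFunc ℝ) :
    (complexify g).num * g.denom.map (algebraMap ℝ ℂ) =
      g.num.map (algebraMap ℝ ℂ) * (complexify g).denom := by
  have h := (RatFunc.num_div_denom (complexify g)).trans (complexify_apply g)
  rw [div_eq_div_iff (RatFunc.algebraMap_ne_zero (complexify g).denom_ne_zero)
    (RatFunc.algebraMap_ne_zero (denom_map_ne_zero g)), ← map_mul, ← map_mul] at h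
  exact RatFunc.algebraMap_injective ℂ h

theorem complexify_mem_stableSubring {g : RatFunc ℝ} :
    complexify g ∈ stableSubring ℂ ↔ g ∈ stableSubring ℝ := by
  constructor
  · intro h p hp
    rw [Polynomial.aeval_def, Polynomial.eval₂_eq_eval_map] at hp
    refine h p ?_
    have h1 := congrArg (Polynomial.eval p) (complexify_num_mul g)
    rw [Polynomial.eval_mul, Polynomial.eval_mul, hp, mul_zero] at h1
    -- The Bézout identity survives the extension to ℂ, so the numerator cannot vanish at the root
    -- `p` of the denominator.
    have hco := (RatFunc.isCoprime_num_denom g).map (Polynomial.mapRingHom (algebraMap ℝ ℂ))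
    obtain ⟨a, b, hab⟩ := hco
    have h2 := congrArg (Polynomial.eval p) hab
    simp only [Polynomial.coe_mapRingHom, Polynomial.eval_add, Polynomial.eval_mul, hp, mul_zero,
      add_zero, Polynomial.eval_one] at h2
    rw [Polynomial.coe_aeval_eq_eval]
    refine (mul_eq_zero.1 h1.symm).resolve_left fun h3 => ?_
    rw [h3, mul_zero] at h2
    exact zero_ne_one h2
  · intro h p hp
    refine h p ?_
    have hd : (complexify g).denom ∣ g.denom.map (algebraMap ℝ ℂ) := by
      rw [complexify_apply]
      exact RatFunc.denom_div_dvd _ _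
    rw [Polynomial.aeval_def, Polynomial.eval₂_eq_eval_map, ← Polynomial.coe_aeval_eq_eval]
    exact zero_dvd_iff.1 (hp ▸ map_dvd (Polynomial.aeval p) hd)

theorem isRHInf_complexify {g : RatFunc ℝ} : IsRHInf (complexify g) ↔ IsRHInf g := by
  rw [isRHInf_iff, isRHInf_iff, complexify_mem_stableSubring, DegLE, DegLE, intDegree_complexify,
    map_ne_zero_iff _ complexify_injective]

theorem eval_complexify {g : RatFunc ℝ} (hg : g ∈ stableSubring ℝ) {z : ℂ} (hz : ‖z‖ = 1) :
    RatFunc.eval (algebraMap ℂ ℂ) z (complexify g) = RatFunc.eval (algebraMap ℝ ℂ) z g := by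
  have h1 := congrArg (Polynomial.eval z) (complexify_num_mul g)
  simp only [Polynomial.eval_mul] at h1
  have h2 := eval₂_denom_ne_zero_of_mem hg hz
  have h3 := eval₂_denom_ne_zero_of_mem (complexify_mem_stableSubring.2 hg) hz
  rw [RatFunc.eval, RatFunc.eval, div_eq_div_iff h3 h2]
  simpa [Polynomial.eval₂_eq_eval_map] using h1

/-! ### Spatial transforms -/

/-- The character `e^{-ikθ}`. -/
def character (k : ℤ) (θ : ℝ) : ℂ := Complex.exp (-(Complex.I * (k : ℂ) * (θ : ℂ)))

theorem character_add (k l : ℤ) (θ : ℝ) :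
    character (k + l) θ = character k θ * character l θ := by
  rw [character, character, character, ← Complex.exp_add]
  push_cast
  ring_nf

@[simp]
theorem character_zero (θ : ℝ) : character 0 θ = 1 := by simp [character]

theorem character_neg_mul_self (k : ℤ) (θ : ℝ) : character (-k) θ * character k θ = 1 := by
  rw [← character_add, neg_add_cancel, character_zero]

theorem conj_character (k : ℤ) (θ : ℝ) :
    (starRingEnd ℂ) (character k θ) = character (-k) θ := by
  simp [character, ← Complex.exp_conj]

theorem character_one_add (θ : ℝ) :
    character 1 θ + character (-1) θ = ((2 * Real.cos θ : ℝ) : ℂ) := by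
  simp only [character]
  push_cast
  rw [Complex.two_cos]
  ring_nf

theorem continuous_character (k : ℤ) : Continuous (character k) := by
  unfold character
  fun_prop

/-- The transform `∑_{|k| ≤ E} a_k e^{-ikθ}` of a sequence indexed by `ℤ`. -/
def seqTransform (E : ℕ) (a : ℤ → RatFunc ℝ) (θ : Freq) : RatFunc ℂ :=
  ∑ k ∈ Finset.Icc (-(E : ℤ)) E, RatFunc.C (character k θ) * complexify (a k)

theorem spatialTransform_restrict {E : ℕ} (a : ℤ → RatFunc ℝ) (θ : Freq) :
    spatialTransform (fun k : Site E => a k) θ = seqTransform E a θ :=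
  Finset.sum_coe_sort (Finset.Icc (-(E : ℤ)) E)
    fun k => RatFunc.C (character k θ) * complexify (a k)

/-- Extension of a column by zero. -/
def extendZero {E : ℕ} (g : Site E → RatFunc ℝ) (k : ℤ) : RatFunc ℝ :=
  if h : k ∈ Finset.Icc (-(E : ℤ)) E then g ⟨k, h⟩ else 0

@[simp]
theorem extendZero_coe {E : ℕ} (g : Site E → RatFunc ℝ) (k : Site E) :
    extendZero g (k : ℤ) = g k := by
  rw [extendZero, dif_pos k.2]

theorem extendZero_eq_zero {E : ℕ} (g : Site E → RatFunc ℝ) {k : ℤ} (hk : (E : ℤ) < |k|) :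
    extendZero g k = 0 := by
  rw [extendZero, dif_neg]
  rw [Finset.mem_Icc, ← abs_le]
  exact not_le.2 hk

theorem spatialTransform_eq_seqTransform {E : ℕ} (g : Site E → RatFunc ℝ) (θ : Freq) :
    spatialTransform g θ = seqTransform E (extendZero g) θ := by
  rw [← spatialTransform_restrict]
  simp only [extendZero_coe]

theorem seqTransform_of_le {E E' : ℕ} (h : E ≤ E') {a : ℤ → RatFunc ℝ}
    (ha : ∀ k, (E : ℤ) < |k| → a k = 0) (θ : Freq) :
    seqTransform E' a θ = seqTransform E a θ := by
  refine (Finset.sum_subset ?_ ?_).symm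
  · exact Finset.Icc_subset_Icc (by lia) (by lia)
  · intro k _ hk
    rw [Finset.mem_Icc, ← abs_le, not_le] at hk
    rw [ha k hk, map_zero, mul_zero]

theorem spatialTransform_add {E : ℕ} (f g : Site E → RatFunc ℝ) (θ : Freq) :
    spatialTransform (f + g) θ = spatialTransform f θ + spatialTransform g θ := by
  simp only [spatialTransform, Pi.add_apply, map_add, mul_add, Finset.sum_add_distrib]

theorem spatialTransform_smul {E : ℕ} (c : RatFunc ℝ) (g : Site E → RatFunc ℝ) (θ : Freq) :
    spatialTransform (c • g) θ = complexify c * spatialTransform g θ := by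
  simp only [spatialTransform, Pi.smul_apply, smul_eq_mul, map_mul, Finset.mul_sum]
  exact Finset.sum_congr rfl fun _ _ => by ring

/-- Since `n + b ≤ m`, the band `[-b, b]` translated by `j` stays inside `[-m, m]`: nothing is
truncated at the edges. This is why the row range must exceed the column range by the bandwidth. -/
theorem sum_Icc_shift {M : Type*} [AddCommMonoid M] (F : ℤ → M) {b m n : ℕ} (hm : n + b ≤ m)
    (hF : ∀ d, (b : ℤ) < |d| → F d = 0) {j : ℤ} (hj : j ∈ Finset.Icc (-(n : ℤ)) n) :
    ∑ i ∈ Finset.Icc (-(m : ℤ)) m, F (i - j) = ∑ d ∈ Finset.Icc (-(b : ℤ)) b, F d := by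
  rw [Finset.mem_Icc] at hj
  have hmap : ∑ d ∈ Finset.Icc (-(b : ℤ)) b, F d =
      ∑ i ∈ (Finset.Icc (-(b : ℤ)) b).map (addRightEmbedding j), F (i - j) := by
    simp only [Finset.sum_map, addRightEmbedding_apply, add_sub_cancel_right]
  rw [hmap]
  symm
  refine Finset.sum_subset ?_ ?_
  · intro i hi
    simp only [Finset.mem_map, Finset.mem_Icc, addRightEmbedding_apply] at hi ⊢
    lia
  · intro i _ hi
    refine hF _ (not_le.1 fun h => hi ?_)
    rw [abs_le] at h
    simp only [Finset.mem_map, Finset.mem_Icc, addRightEmbedding_apply]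
    exact ⟨i - j, by lia, by ring⟩

/-- A banded Toeplitz matrix acts as multiplication in the frequency domain. -/
theorem seqTransform_convolution {b m n : ℕ} (hm : n + b ≤ m) {a : ℤ → RatFunc ℝ}
    (ha : ∀ d, (b : ℤ) < |d| → a d = 0) (x : ℤ → RatFunc ℝ) (θ : Freq) :
    seqTransform m (fun i => ∑ j ∈ Finset.Icc (-(n : ℤ)) n, a (i - j) * x j) θ =
      seqTransform b a θ * seqTransform n x θ := by
  simp only [seqTransform, map_sum, map_mul, Finset.mul_sum]
  rw [Finset.sum_comm]
  refine Finset.sum_congr rfl fun j hj => ?_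
  rw [Finset.sum_mul, ← sum_Icc_shift (fun d => RatFunc.C (character d θ) * complexify (a d) *
    (RatFunc.C (character j θ) * complexify (x j))) hm (fun d hd => by simp [ha d hd]) hj]
  refine Finset.sum_congr rfl fun i _ => ?_
  have : character i θ = character (i - j) θ * character j θ := by
    rw [← character_add, sub_add_cancel]
  rw [this, map_mul]
  ring

theorem spatialTransform_toeplitz {b m n : ℕ} (hm : n + b ≤ m) {a : ℤ → RatFunc ℝ}
    (ha : ∀ d, (b : ℤ) < |d| → a d = 0) (x : Site n → RatFunc ℝ) (θ : Freq) :
    spatialTransform ((Matrix.of fun (i : Site m) (j : Site n) => a ((i : ℤ) - j)).mulVec x) θ =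
      seqTransform b a θ * spatialTransform x θ := by
  rw [spatialTransform_eq_seqTransform x, ← seqTransform_convolution hm ha,
    ← spatialTransform_restrict]
  congr 1
  funext i
  simp only [Matrix.mulVec, dotProduct, Matrix.of_apply]
  rw [← Finset.sum_coe_sort (Finset.Icc (-(n : ℤ)) n)]
  simp only [extendZero_coe]

/-! ### Extents -/

theorem HasExtent.mono {G : Freq → RatFunc ℂ} {E E' : ℕ} (h : HasExtent G E) (hE : E ≤ E') :
    HasExtent G E' := by
  obtain ⟨g, hg⟩ := h
  refine ⟨fun k => extendZero g k, fun θ => ?_⟩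
  rw [hg, spatialTransform_restrict, seqTransform_of_le hE fun _ => extendZero_eq_zero g,
    spatialTransform_eq_seqTransform]

theorem HasExtent.add {G H : Freq → RatFunc ℂ} {E : ℕ} (hG : HasExtent G E)
    (hH : HasExtent H E) : HasExtent (fun θ => G θ + H θ) E := by
  obtain ⟨g, hg⟩ := hG
  obtain ⟨h, hh⟩ := hH
  exact ⟨g + h, fun θ => by simp only [hg, hh, spatialTransform_add]⟩

/-- The product has as kernel the convolution, realized as a banded Toeplitz matrix acting on a
column, so bandwidths add. -/
theorem HasExtent.mul {G H : Freq → RatFunc ℂ} {E E' : ℕ} (hG : HasExtent G E)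
    (hH : HasExtent H E') : HasExtent (fun θ => G θ * H θ) (E + E') := by
  obtain ⟨g, hg⟩ := hG
  obtain ⟨h, hh⟩ := hH
  refine ⟨(Matrix.of fun (i : Site (E + E')) (j : Site E') =>
    extendZero g ((i : ℤ) - j)).mulVec h, fun θ => ?_⟩
  rw [spatialTransform_toeplitz (add_comm E' E).le fun _ => extendZero_eq_zero g,
    ← spatialTransform_eq_seqTransform g, ← hg, ← hh]

theorem hasExtent_complexify (c : RatFunc ℝ) : HasExtent (fun _ => complexify c) 0 := by
  refine ⟨fun _ => c, fun θ => ?_⟩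
  rw [spatialTransform_restrict fun _ => c]
  simp [seqTransform]

theorem HasExtent.smul {G : Freq → RatFunc ℂ} {E : ℕ} (hG : HasExtent G E) (c : RatFunc ℝ) :
    HasExtent (fun θ => complexify c * G θ) E :=
  ((hasExtent_complexify c).mul hG).mono (zero_add E).le

theorem HasExtent.sub {G H : Freq → RatFunc ℂ} {E : ℕ} (hG : HasExtent G E)
    (hH : HasExtent H E) : HasExtent (fun θ => G θ - H θ) E := by
  have h := hG.add (hH.smul (-1))
  simpa [sub_eq_add_neg] using h

/-- The sequence with value `p` at `0`, `q` at `±1` and `0` elsewhere. -/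
def tridiagonal (p q : RatFunc ℝ) (k : ℤ) : RatFunc ℝ :=
  if |k| = 0 then p else if |k| = 1 then q else 0

theorem tridiagonal_eq_zero (p q : RatFunc ℝ) {n : ℕ} (hn : 1 ≤ n) (k : ℤ)
    (hk : (n : ℤ) < |k|) : tridiagonal p q k = 0 := by
  rw [tridiagonal, if_neg (by lia), if_neg (by lia)]

theorem seqTransform_tridiagonal {n : ℕ} (hn : 1 ≤ n) (p q : RatFunc ℝ) (θ : Freq) :
    seqTransform n (tridiagonal p q) θ =
      complexify p + complexify q * RatFunc.C ((2 * Real.cos θ : ℝ) : ℂ) := by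
  rw [seqTransform_of_le hn fun k => tridiagonal_eq_zero p q le_rfl k, seqTransform]
  have : Finset.Icc (-((1 : ℕ) : ℤ)) ((1 : ℕ) : ℤ) = {-1, 0, 1} := by
    ext k
    simp only [Finset.mem_Icc, Finset.mem_insert, Finset.mem_singleton]
    lia
  rw [this, ← character_one_add]
  simp [tridiagonal]
  ring

/-- The sequence with value `p` at `0`, `q` at `±1`, `r` at `±2` and `0` elsewhere. -/
def pentadiagonal (p q r : RatFunc ℝ) (k : ℤ) : RatFunc ℝ :=
  if |k| = 0 then p else if |k| = 1 then q else if |k| = 2 then r else 0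

theorem pentadiagonal_eq_zero (p q r : RatFunc ℝ) (k : ℤ) (hk : ((2 : ℕ) : ℤ) < |k|) :
    pentadiagonal p q r k = 0 := by
  rw [pentadiagonal, if_neg (by lia), if_neg (by lia), if_neg (by lia)]

/-- The last term comes from e^{2iθ} + e^{-2iθ} = (2 cos θ)² - 2. -/
theorem seqTransform_pentadiagonal (p q r : RatFunc ℝ) (θ : Freq) :
    seqTransform 2 (pentadiagonal p q r) θ =
      complexify p + complexify q * RatFunc.C ((2 * Real.cos θ : ℝ) : ℂ) +
        complexify r * (RatFunc.C ((2 * Real.cos θ : ℝ) : ℂ) ^ 2 - 2) := by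
  have : Finset.Icc (-((2 : ℕ) : ℤ)) ((2 : ℕ) : ℤ) = {-2, -1, 0, 1, 2} := by
    ext k
    simp only [Finset.mem_Icc, Finset.mem_insert, Finset.mem_singleton]
    lia
  have h2 : character 2 θ = character 1 θ * character 1 θ := by
    rw [← character_add]
    norm_num
  have h2' : character (-2) θ = character (-1) θ * character (-1) θ := by
    rw [← character_add]
    norm_num
  have h1 : RatFunc.C (character (-1) θ) * RatFunc.C (character 1 θ) = 1 := by
    rw [← map_mul, character_neg_mul_self, map_one]
  rw [seqTransform, this, ← character_one_add]
  simp [pentadiagonal, h2, h2']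
  linear_combination (-2 * complexify r) * h1

/-! ### Inversion of the spatial transform -/

/-- The frequency `2πj / (2E+1)`. -/
def sampleFreq {E : ℕ} (j : Fin (2 * E + 1)) : Freq :=
  ⟨2 * Real.pi * (j : ℝ) / (2 * E + 1), by
    have hE : (0 : ℝ) < 2 * E + 1 := by positivity
    have hj : ((j : ℕ) : ℝ) < 2 * E + 1 := by exact_mod_cast j.2
    refine ⟨by positivity, ?_⟩
    rw [div_lt_iff₀ hE]
    exact mul_lt_mul_of_pos_left hj Real.two_pi_pos⟩

/-- A geometric sum of powers of a (2E+1)-th root of unity. The root is not 1, since 2E+1 cannot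
divide a nonzero `d` with |d| ≤ 2E; two sites differ by at most this much. -/
theorem sum_character_sampleFreq {E : ℕ} {d : ℤ} (hd : d ≠ 0) (hdE : |d| ≤ 2 * E) :
    ∑ j : Fin (2 * E + 1), character d (sampleFreq j) = 0 := by
  set ω := Complex.exp (-(Complex.I * (d : ℂ) * (2 * Real.pi / (2 * E + 1)))) with hω
  have hE : (2 * (E : ℂ) + 1) ≠ 0 := by exact_mod_cast (2 * E).succ_ne_zero
  have hpow (j : Fin (2 * E + 1)) : character d (sampleFreq j) = ω ^ (j : ℕ) := by
    rw [hω, ← Complex.exp_nat_mul, character, sampleFreq]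
    push_cast
    ring_nf
  have hN : ω ^ (2 * E + 1) = 1 := by
    rw [hω, ← Complex.exp_nat_mul, Complex.exp_eq_one_iff]
    refine ⟨-d, ?_⟩
    push_cast
    field_simp
  have h1 : ω ≠ 1 := by
    rw [hω, Ne, Complex.exp_eq_one_iff]
    rintro ⟨n, hn⟩
    have hpi : (Real.pi : ℂ) ≠ 0 := by exact_mod_cast Real.pi_ne_zero
    have h : (d : ℂ) = -(n * (2 * E + 1)) := by
      field_simp at hn
      linear_combination -hn
    have h' : d = -(n * (2 * E + 1)) := by exact_mod_cast h
    have hn0 : n ≠ 0 := by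
      rintro rfl
      simp at h'
      exact hd h'
    rw [h', abs_neg, abs_mul, abs_of_nonneg (by positivity : (0 : ℤ) ≤ 2 * E + 1)] at hdE
    have := Int.one_le_abs hn0
    nlinarith
  simp only [hpow]
  rw [Fin.sum_univ_eq_sum_range fun j => ω ^ j, geom_sum_eq h1, hN, sub_self, zero_div]

theorem sum_character_mul_spatialTransform {E : ℕ} (g : Site E → RatFunc ℝ) (k : Site E) :
    ∑ j : Fin (2 * E + 1), RatFunc.C (character (-k) (sampleFreq j)) *
      spatialTransform g (sampleFreq j) = RatFunc.C (2 * E + 1 : ℂ) * complexify (g k) := by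
  simp only [spatialTransform, Finset.mul_sum]
  rw [Finset.sum_comm, Finset.sum_eq_single k]
  · have (j : Fin (2 * E + 1)) : RatFunc.C (character (-k) (sampleFreq j)) *
        (RatFunc.C (Complex.exp (-(Complex.I * ((k : ℤ) : ℂ) * ((sampleFreq j : ℝ) : ℂ)))) *
          complexify (g k)) = complexify (g k) := by
      rw [← mul_assoc, ← map_mul, ← character, character_neg_mul_self, map_one, one_mul]
    have hC : RatFunc.C (2 : ℂ) = 2 := map_ofNat _ 2
    simp [this, hC]
  · intro l _ hl
    have (j : Fin (2 * E + 1)) : RatFunc.C (character (-k) (sampleFreq j)) *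
        (RatFunc.C (Complex.exp (-(Complex.I * ((l : ℤ) : ℂ) * ((sampleFreq j : ℝ) : ℂ)))) *
          complexify (g l)) =
        RatFunc.C (character (-k + l) (sampleFreq j)) * complexify (g l) := by
      rw [← mul_assoc, ← map_mul, ← character, character_add]
    simp only [this]
    have hk' := Finset.mem_Icc.1 k.2
    have hl' := Finset.mem_Icc.1 l.2
    have hne : (l : ℤ) ≠ k := fun h => hl (Subtype.ext h)
    rw [← Finset.sum_mul, ← map_sum, sum_character_sampleFreq (by lia)
      (abs_le.2 ⟨by lia, by lia⟩), map_zero, zero_mul]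
  · simp

/-- Finite Fourier inversion. The weights are complex constants, so any property of transfer
functions closed under ℂ-linear combinations passes from the frequency domain to each index-domain
coefficient. -/
theorem complexify_eq_sum {E : ℕ} (g : Site E → RatFunc ℝ) (k : Site E) :
    complexify (g k) = RatFunc.C (2 * E + 1 : ℂ)⁻¹ * ∑ j : Fin (2 * E + 1),
      RatFunc.C (character (-k) (sampleFreq j)) * spatialTransform g (sampleFreq j) := by
  have hE : (2 * (E : ℂ) + 1) ≠ 0 := by exact_mod_cast (2 * E).succ_ne_zero
  rw [sum_character_mul_spatialTransform, ← mul_assoc, ← map_mul, inv_mul_cancel₀ hE, map_one,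
    one_mul]

theorem spatialTransform_injective {E : ℕ} {f g : Site E → RatFunc ℝ}
    (h : ∀ θ, spatialTransform f θ = spatialTransform g θ) : f = g := by
  funext k
  apply complexify_injective
  rw [complexify_eq_sum f, complexify_eq_sum g]
  simp only [h]

theorem isRHInf_of_spatialTransform {E : ℕ} {f : Site E → RatFunc ℝ}
    (h : ∀ θ, IsRHInf (spatialTransform f θ)) (k : Site E) : IsRHInf (f k) := by
  rw [← isRHInf_complexify, complexify_eq_sum f k]
  exact (isRHInf_sum _ _ fun j _ => (h _).C_mul _).C_mul _

theorem mem_stableSubring_of_spatialTransform {E : ℕ} {f : Site E → RatFunc ℝ}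
    (h : ∀ θ, spatialTransform f θ ∈ stableSubring ℂ) (k : Site E) : f k ∈ stableSubring ℝ := by
  rw [← complexify_mem_stableSubring, complexify_eq_sum f k]
  exact mul_mem (C_mem_stableSubring _)
    (sum_mem fun j _ => mul_mem (C_mem_stableSubring _) (h _))

theorem isRHInf_spatialTransform {E : ℕ} {f : Site E → RatFunc ℝ} (h : f ∈ RHInfVec E)
    (θ : Freq) : IsRHInf (spatialTransform f θ) :=
  isRHInf_sum _ _ fun k _ => (isRHInf_complexify.2 (h k)).C_mul _

/-! ### Parseval's identity -/

theorem integral_character {d : ℤ} (hd : d ≠ 0) :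
    ∫ θ in (0 : ℝ)..2 * Real.pi, character d θ = 0 := by
  have hc : -(Complex.I * d) ≠ 0 := by simp [hd]
  have h := integral_exp_mul_complex (a := 0) (b := 2 * Real.pi) hc
  have h1 : Complex.exp (-(Complex.I * d) * ((2 * Real.pi : ℝ) : ℂ)) = 1 := by
    rw [Complex.exp_eq_one_iff]
    exact ⟨-d, by push_cast; ring⟩
  rw [h1] at h
  simpa [character] using h

/-- Expanding the square gives a double sum of characters `k - l`, and only the diagonal survives
integration. -/
theorem integral_norm_sq_trigPolynomial {E : ℕ} (a : Site E → ℂ) :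
    ∫ θ in (0 : ℝ)..2 * Real.pi, ‖∑ k : Site E, character k θ * a k‖ ^ 2 =
      2 * Real.pi * ∑ k, ‖a k‖ ^ 2 := by
  have h1 (θ : ℝ) : ((‖∑ k : Site E, character k θ * a k‖ ^ 2 : ℝ) : ℂ) =
      ∑ k : Site E, ∑ l : Site E, character (k - l) θ * (a k * (starRingEnd ℂ) (a l)) := by
    push_cast
    rw [← Complex.mul_conj', map_sum, Finset.sum_mul_sum]
    refine Finset.sum_congr rfl fun k _ => Finset.sum_congr rfl fun l _ => ?_
    rw [map_mul, conj_character, sub_eq_add_neg, character_add]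
    ring
  have h2 : ((∫ θ in (0 : ℝ)..2 * Real.pi, ‖∑ k : Site E, character k θ * a k‖ ^ 2 : ℝ) : ℂ) =
      ((2 * Real.pi * ∑ k, ‖a k‖ ^ 2 : ℝ) : ℂ) := by
    rw [← intervalIntegral.integral_ofReal]
    simp only [h1]
    have hint (k l : Site E) : IntervalIntegrable
        (fun θ => character (k - l) θ * (a k * (starRingEnd ℂ) (a l))) volume 0 (2 * Real.pi) :=
      ((continuous_character _).mul continuous_const).intervalIntegrable _ _
    have hint' (k : Site E) : IntervalIntegrable
        (fun θ => ∑ l : Site E, character (k - l) θ * (a k * (starRingEnd ℂ) (a l))) volume 0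
          (2 * Real.pi) :=
      (continuous_finsetSum _ fun l _ =>
        (continuous_character _).mul continuous_const).intervalIntegrable _ _
    rw [intervalIntegral.integral_finsetSum fun k _ => hint' k]
    push_cast
    rw [Finset.mul_sum]
    refine Finset.sum_congr rfl fun k _ => ?_
    rw [intervalIntegral.integral_finsetSum fun l _ => hint k l, Finset.sum_eq_single k]
    · simp [Complex.mul_conj']
    · intro l _ hl
      rw [intervalIntegral.integral_mul_const, integral_character, zero_mul]
      exact fun h => hl (Subtype.ext (sub_eq_zero.1 h).symm)
    · simp
  exact_mod_cast h2

theorem lintegral_norm_sq_trigPolynomial {E : ℕ} (a : Site E → ℂ) :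
    ∫⁻ θ in Set.Ico (0 : ℝ) (2 * Real.pi), ‖∑ k : Site E, character k θ * a k‖ₑ ^ 2 =
      ENNReal.ofReal (2 * Real.pi) * ∑ k, ‖a k‖ₑ ^ 2 := by
  have he (w : ℂ) : ‖w‖ₑ ^ 2 = ENNReal.ofReal (‖w‖ ^ 2) := by
    rw [ENNReal.ofReal_pow (norm_nonneg w), ofReal_norm]
  have hc : Continuous fun θ : ℝ => ‖∑ k : Site E, character k θ * a k‖ ^ 2 :=
    (continuous_finsetSum _ fun k _ => (continuous_character _).mul continuous_const).norm.pow 2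
  simp only [he]
  rw [← ENNReal.ofReal_sum_of_nonneg fun _ _ => by positivity,
    ← ENNReal.ofReal_mul Real.two_pi_pos.le, ← integral_norm_sq_trigPolynomial a,
    intervalIntegral.integral_of_le Real.two_pi_pos.le, ← integral_Ico_eq_integral_Ioc,
    ofReal_integral_eq_lintegral_ofReal]
  · exact (hc.integrableOn_Icc (a := 0) (b := 2 * Real.pi)).mono_set Set.Ico_subset_Icc_self
  · exact Filter.Eventually.of_forall fun _ => by positivity

/-! ### The closed loop in terms of the characteristic polynomial -/

section Loop

variable (α β κ : ℝ)

theorem X_sub_C_ne_zero (a : ℂ) : (RatFunc.X - RatFunc.C a : RatFunc ℂ) ≠ 0 := by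
  rw [← RatFunc.algebraMap_X, ← RatFunc.algebraMap_C, ← map_sub]
  exact RatFunc.algebraMap_ne_zero (Polynomial.X_sub_C_ne_zero a)

theorem intDegree_X_sub_C (a : ℂ) : (RatFunc.X - RatFunc.C a : RatFunc ℂ).intDegree = 1 := by
  rw [← RatFunc.algebraMap_X, ← RatFunc.algebraMap_C, ← map_sub, RatFunc.intDegree_polynomial,
    Polynomial.natDegree_X_sub_C]
  rfl

theorem charPoly_ne_zero (θ : Freq) : charPoly α β κ θ ≠ 0 :=
  mul_ne_zero (X_sub_C_ne_zero _) (X_sub_C_ne_zero _)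

theorem intDegree_charPoly (θ : Freq) : (charPoly α β κ θ).intDegree = 2 := by
  rw [charPoly, RatFunc.intDegree_mul (X_sub_C_ne_zero _) (X_sub_C_ne_zero _),
    intDegree_X_sub_C, intDegree_X_sub_C]
  rfl

theorem degLE_charPoly (θ : Freq) : DegLE (charPoly α β κ θ) 2 := fun _ =>
  (intDegree_charPoly α β κ θ).le

theorem degLE_inv_charPoly (θ : Freq) : DegLE (charPoly α β κ θ)⁻¹ (-2) := fun _ => by
  rw [RatFunc.intDegree_inv, intDegree_charPoly]

theorem charPoly_mem_stableSubring (θ : Freq) : charPoly α β κ θ ∈ stableSubring ℂ :=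
  mul_mem (sub_mem X_mem_stableSubring (C_mem_stableSubring _))
    (sub_mem X_mem_stableSubring (C_mem_stableSubring _))

theorem charPoly_eq (θ : Freq) : charPoly α β κ θ =
    RatFunc.X ^ 2 - RatFunc.X * RatFunc.C ((sigma α κ θ + β : ℝ) : ℂ) +
      RatFunc.C ((sigma α κ θ * β : ℝ) : ℂ) := by
  rw [charPoly]
  push_cast
  rw [map_add, map_mul]
  ring

theorem plantResolvent_eq (θ : Freq) : plantResolvent α β κ θ =
    !![(RatFunc.X - RatFunc.C (β : ℂ))⁻¹, (charPoly α β κ θ)⁻¹;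
      0, (RatFunc.X - RatFunc.C (sigma α κ θ : ℂ))⁻¹] := by
  have h1 := X_sub_C_ne_zero (β : ℂ)
  have h2 := X_sub_C_ne_zero (sigma α κ θ : ℂ)
  refine Matrix.inv_eq_right_inv ?_
  ext i j
  fin_cases i <;> fin_cases j <;>
    simp [matA, Matrix.mul_apply, Fin.sum_univ_two, charPoly, h1, h2]
  rw [mul_left_comm, mul_inv_cancel₀ h1, mul_one, add_neg_cancel]

/-- The loop sees the plant only through this scalar, so every closed-loop map is a function of
`charPoly` and `K`. -/
theorem plantYU_eq (θ : Freq) : plantYU α β κ θ = (charPoly α β κ θ)⁻¹ := by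
  simp [plantYU, plantResolvent_eq, matC2, matB2, Matrix.mul_apply, Fin.sum_univ_two]

theorem plantZW_eq (θ : Freq) : plantZW α β κ θ =
    !![0, (charPoly α β κ θ)⁻¹; 0, (RatFunc.X - RatFunc.C (sigma α κ θ : ℂ))⁻¹; 0, 0] := by
  ext i j
  fin_cases i <;> fin_cases j <;>
    simp [plantZW, plantResolvent_eq, matC1, matB1, Matrix.mul_apply, Fin.sum_univ_two]

theorem plantZU_eq (θ : Freq) : plantZU α β κ θ =
    !![(charPoly α β κ θ)⁻¹; (RatFunc.X - RatFunc.C (sigma α κ θ : ℂ))⁻¹; 1] := by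
  ext i j
  fin_cases i <;> fin_cases j <;>
    simp [plantZU, plantResolvent_eq, matC1, matB2, matD12, Matrix.mul_apply, Fin.sum_univ_two]

theorem plantYW_eq (θ : Freq) : plantYW α β κ θ = !![1, (charPoly α β κ θ)⁻¹] := by
  ext i j
  fin_cases i
  fin_cases j <;>
    simp [plantYW, plantResolvent_eq, matC2, matB1, matD21, Matrix.mul_apply, Fin.sum_univ_two]

variable (K : Controller) (θ : Freq)

theorem det_loopMatrix :
    (loopMatrix α β κ K θ).det = 1 - (charPoly α β κ θ)⁻¹ * K θ := by
  rw [loopMatrix, Matrix.det_fin_two_of, plantYU_eq]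
  ring

/-- No well-posedness is needed: for a singular loop matrix both sides are 0 by the conventions for
inverses. -/
theorem ioMaps_eq : ioMaps α β κ K θ =
    (1 - (charPoly α β κ θ)⁻¹ * K θ)⁻¹ • !![1, (charPoly α β κ θ)⁻¹; K θ, 1] := by
  rw [ioMaps, Matrix.inv_def, det_loopMatrix, Ring.inverse_eq_inv', loopMatrix,
    Matrix.adjugate_fin_two_of, plantYU_eq, neg_neg, neg_neg]

theorem Gam_eq : Gam α β κ K θ = (1 - (charPoly α β κ θ)⁻¹ * K θ)⁻¹ := by
  simp [Gam, ioMaps_eq]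

theorem Ome_eq : Ome α β κ K θ = (1 - (charPoly α β κ θ)⁻¹ * K θ)⁻¹ := by
  simp [Ome, ioMaps_eq]

theorem Lam_eq : Lam α β κ K θ =
    (1 - (charPoly α β κ θ)⁻¹ * K θ)⁻¹ * (charPoly α β κ θ)⁻¹ := by
  simp [Lam, ioMaps_eq]

theorem Psi_eq : Psi α β κ K θ = (1 - (charPoly α β κ θ)⁻¹ * K θ)⁻¹ * K θ := by
  simp [Psi, ioMaps_eq]

theorem Gam_eq_charPoly_mul : Gam α β κ K θ = charPoly α β κ θ * Lam α β κ K θ := by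
  rw [Gam_eq, Lam_eq, mul_left_comm, mul_inv_cancel₀ (charPoly_ne_zero α β κ θ), mul_one]

theorem Ome_eq_charPoly_mul : Ome α β κ K θ = charPoly α β κ θ * Lam α β κ K θ := by
  rw [← Gam_eq_charPoly_mul, Gam_eq, Ome_eq]

variable {K θ}

/-- With D = Γ, the claim reduces to D(c - K) = c, because c - K = (1 - c⁻¹K)c. Unlike the
identities for Γ and Ω, this one fails when D is the default value 0. -/
theorem Psi_eq_charPoly_mul (h : (loopMatrix α β κ K θ).det ≠ 0) :
    Psi α β κ K θ = charPoly α β κ θ ^ 2 * Lam α β κ K θ - charPoly α β κ θ := by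
  rw [det_loopMatrix] at h
  have hc := charPoly_ne_zero α β κ θ
  have h' : (1 - (charPoly α β κ θ)⁻¹ * K θ)⁻¹ * (charPoly α β κ θ - K θ) =
      charPoly α β κ θ := by
    have : charPoly α β κ θ - K θ =
        (1 - (charPoly α β κ θ)⁻¹ * K θ) * charPoly α β κ θ := by
      field_simp
    rw [this, inv_mul_cancel_left₀ h]
  rw [pow_two, mul_assoc, ← Gam_eq_charPoly_mul, Gam_eq, Psi_eq]
  linear_combination -h'

theorem controller_eq (h : (loopMatrix α β κ K θ).det ≠ 0) :
    K θ = (charPoly α β κ θ ^ 2 * Lam α β κ K θ - charPoly α β κ θ) *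
      (charPoly α β κ θ * Lam α β κ K θ)⁻¹ := by
  rw [← Psi_eq_charPoly_mul α β κ h, ← Gam_eq_charPoly_mul, Gam_eq, Psi_eq, inv_inv, mul_comm,
    mul_inv_cancel_left₀]
  rwa [det_loopMatrix] at h

theorem closedLoop_eq (h : (loopMatrix α β κ K θ).det ≠ 0) :
    closedLoop α β κ K θ =
      !![Gam α β κ K θ - 1, Lam α β κ K θ;
        (RatFunc.X - RatFunc.C (β : ℂ)) * (Gam α β κ K θ - 1),
          (RatFunc.X - RatFunc.C (β : ℂ)) * Lam α β κ K θ;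
        Psi α β κ K θ, Ome α β κ K θ - 1] := by
  rw [det_loopMatrix] at h
  have h1 := X_sub_C_ne_zero (β : ℂ)
  have h2 := X_sub_C_ne_zero (sigma α κ θ : ℂ)
  have hr : (RatFunc.X - RatFunc.C (sigma α κ θ : ℂ))⁻¹ =
      (RatFunc.X - RatFunc.C (β : ℂ)) * (charPoly α β κ θ)⁻¹ := by
    rw [charPoly, mul_inv, mul_inv_cancel_left₀ h1]
  rw [closedLoop, plantZW_eq, plantZU_eq, plantYW_eq, plantYU_eq, Gam_eq, Ome_eq, Lam_eq, Psi_eq,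
    hr]
  -- With q = c⁻¹ and D = (1 - qk)⁻¹ as free symbols, every entry follows from D(1 - qk) = 1 by
  -- linear combination.
  generalize (charPoly α β κ θ)⁻¹ = q at *
  generalize K θ = k at *
  have hD := inv_mul_cancel₀ h
  generalize (1 - q * k)⁻¹ = D at *
  ext i j
  fin_cases i <;> fin_cases j <;> simp
  · linear_combination -hD
  · linear_combination -q * hD
  · linear_combination -(RatFunc.X - RatFunc.C (β : ℂ)) * hD
  · linear_combination -(RatFunc.X - RatFunc.C (β : ℂ)) * q * hD
  · ring
  · linear_combination -hD

/-! ### Internal stability -/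

/-- Only properness needs an argument. In Λ = c⁻¹ + c⁻²Ψ the second term is O(z⁻⁴) because Ψ is
proper, and the two terms subtracted in `parameter` are the leading terms of z⁴c⁻¹. -/
theorem isRHInf_parameter (h : (loopMatrix α β κ K θ).det ≠ 0)
    (hL : IsRHInf (Lam α β κ K θ)) (hP : IsRHInf (Psi α β κ K θ)) :
    IsRHInf (parameter α β κ K θ) := by
  have hX := X_mem_stableSubring (F := ℂ)
  refine isRHInf_iff.2 ⟨?_, sub_mem (sub_mem (mul_mem (pow_mem hX 4) hL.mem) (pow_mem hX 2))
    (mul_mem hX (C_mem_stableSubring _))⟩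
  set s := RatFunc.C ((sigma α κ θ + β : ℝ) : ℂ) with hs
  set p := RatFunc.C ((sigma α κ θ * β : ℝ) : ℂ) with hp
  have hc := charPoly_ne_zero α β κ θ
  -- Polynomial division of z⁴ by c = z² - sz + p: the quotient through degree one is z² + sz,
  -- leaving (s² - p)z² - spz.
  have key : parameter α β κ K θ =
      RatFunc.X ^ 4 * (Psi α β κ K θ * ((charPoly α β κ θ)⁻¹ * (charPoly α β κ θ)⁻¹)) +
        ((s * s - p) * RatFunc.X ^ 2 - s * p * RatFunc.X) * (charPoly α β κ θ)⁻¹ := by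
    have hce := charPoly_eq α β κ θ
    rw [Psi_eq_charPoly_mul α β κ h, parameter]
    rw [← hs, ← hp] at hce
    field_simp
    rw [← hs]
    linear_combination (-(RatFunc.X) * (RatFunc.X + s)) * hce
  have hsd : DegLE s 0 := degLE_C _
  have hpd : DegLE p 0 := degLE_C _
  have hi := degLE_inv_charPoly α β κ θ
  rw [key]
  refine DegLE.add ?_ ?_
  · exact ((degLE_X_pow 4).mul (hP.degLE.mul (hi.mul hi))).mono (by norm_num)
  · have h1 : DegLE ((s * s - p) * RatFunc.X ^ 2) 2 :=
      (((hsd.mul hsd).sub (hpd.mono (by norm_num))).mul (degLE_X_pow 2)).mono (by norm_num)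
    have h2 : DegLE (s * p * RatFunc.X) 2 :=
      ((hsd.mul hpd).mul degLE_X).mono (by norm_num)
    exact ((h1.sub h2).mul hi).mono (by norm_num)

variable {E : ℕ} {f : Site E → RatFunc ℝ}

/-- The first two terms of λ are chosen so that cλ has constant coefficient 1 and no z⁻¹ term. The
resulting decay z⁻² is what makes ψ = c(γ - 1) proper. -/
theorem gamOf_sub_one_eq : gamOf α β κ f θ - 1 =
    (RatFunc.X ^ 2)⁻¹ * (RatFunc.C ((sigma α κ θ * β : ℝ) : ℂ) -
      RatFunc.C ((sigma α κ θ + β : ℝ) : ℂ) * RatFunc.C ((sigma α κ θ + β : ℝ) : ℂ) +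
      spatialTransform f θ) +
    (RatFunc.X ^ 3)⁻¹ * (RatFunc.C ((sigma α κ θ + β : ℝ) : ℂ) *
      (RatFunc.C ((sigma α κ θ * β : ℝ) : ℂ) - spatialTransform f θ)) +
    (RatFunc.X ^ 4)⁻¹ * (RatFunc.C ((sigma α κ θ * β : ℝ) : ℂ) * spatialTransform f θ) := by
  have hX := RatFunc.X_ne_zero (K := ℂ)
  rw [gamOf, lamOf, charPoly_eq]
  field_simp
  ring

theorem isRHInf_lamOf (hf : f ∈ RHInfVec E) (θ : Freq) : IsRHInf (lamOf α β κ f θ) := by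
  have hF := isRHInf_spatialTransform hf θ
  refine isRHInf_iff.2 ⟨?_, add_mem (add_mem (inv_X_pow_mem_stableSubring 2)
    (mul_mem (inv_X_pow_mem_stableSubring 3) (C_mem_stableSubring _)))
    (mul_mem (inv_X_pow_mem_stableSubring 4) hF.mem)⟩
  exact (((degLE_inv_X_pow 2).mono (by norm_num)).add
    (((degLE_inv_X_pow 3).mul (degLE_C _)).mono (by norm_num))).add
    (((degLE_inv_X_pow 4).mul hF.degLE).mono (by norm_num))

theorem degLE_gamOf_sub_one (hf : f ∈ RHInfVec E) (θ : Freq) :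
    DegLE (gamOf α β κ f θ - 1) (-2) := by
  have hF := (isRHInf_spatialTransform hf θ).degLE
  rw [gamOf_sub_one_eq]
  have hs := degLE_C (((sigma α κ θ + β : ℝ) : ℂ))
  have hp := degLE_C (((sigma α κ θ * β : ℝ) : ℂ))
  refine (DegLE.add ?_ ?_).add ?_
  · exact ((degLE_inv_X_pow 2).mul ((hp.sub ((hs.mul hs).mono (by norm_num))).add hF)).mono
      (by norm_num)
  · exact ((degLE_inv_X_pow 3).mul (hs.mul (hp.sub hF))).mono (by norm_num)
  · exact ((degLE_inv_X_pow 4).mul (hp.mul hF)).mono (by norm_num)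

theorem gamOf_mem_stableSubring (hf : f ∈ RHInfVec E) (θ : Freq) :
    gamOf α β κ f θ ∈ stableSubring ℂ :=
  mul_mem (charPoly_mem_stableSubring α β κ θ) (isRHInf_lamOf α β κ hf θ).mem

theorem isRHInf_gamOf (hf : f ∈ RHInfVec E) (θ : Freq) : IsRHInf (gamOf α β κ f θ) := by
  refine isRHInf_iff.2 ⟨?_, gamOf_mem_stableSubring α β κ hf θ⟩
  have h := ((degLE_gamOf_sub_one α β κ hf θ).mono (by norm_num : (-2 : ℤ) ≤ 0)).add degLE_one
  rwa [sub_add_cancel] at h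

/-- γ tends to 1 at infinity: γ = 0 would give γ - 1 = -1, of degree 0 rather than at most -2. -/
theorem gamOf_ne_zero (hf : f ∈ RHInfVec E) (θ : Freq) : gamOf α β κ f θ ≠ 0 := fun h => by
  have h1 := degLE_gamOf_sub_one α β κ hf θ
  rw [h, zero_sub] at h1
  have h2 := h1 (neg_ne_zero.2 one_ne_zero)
  rw [RatFunc.intDegree_neg, RatFunc.intDegree_one] at h2
  norm_num at h2

theorem isRHInf_psiOf (hf : f ∈ RHInfVec E) (θ : Freq) : IsRHInf (psiOf α β κ f θ) := by
  have h : psiOf α β κ f θ = charPoly α β κ θ * (gamOf α β κ f θ - 1) := by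
    rw [psiOf, gamOf]
    ring
  rw [h]
  exact isRHInf_iff.2 ⟨((degLE_charPoly α β κ θ).mul (degLE_gamOf_sub_one α β κ hf θ)).mono
    (by norm_num), mul_mem (charPoly_mem_stableSubring α β κ θ)
    (sub_mem (gamOf_mem_stableSubring α β κ hf θ) (one_mem _))⟩

/-- As ψ = c(γ - 1), the determinant is 1 - (γ - 1)/γ; well-posedness thus amounts to γ ≠ 0. -/
theorem det_loopMatrix_controllerOf (hf : f ∈ RHInfVec E) (θ : Freq) :
    (loopMatrix α β κ (controllerOf α β κ f) θ).det = (gamOf α β κ f θ)⁻¹ := by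
  have hc := charPoly_ne_zero α β κ θ
  have hg := gamOf_ne_zero α β κ hf θ
  have hl : lamOf α β κ f θ ≠ 0 := right_ne_zero_of_mul hg
  rw [det_loopMatrix, controllerOf, psiOf, gamOf]
  field_simp
  ring

theorem det_loopMatrix_controllerOf_ne_zero (hf : f ∈ RHInfVec E) (θ : Freq) :
    (loopMatrix α β κ (controllerOf α β κ f) θ).det ≠ 0 := by
  rw [det_loopMatrix_controllerOf α β κ hf]
  exact inv_ne_zero (gamOf_ne_zero α β κ hf θ)

theorem Gam_controllerOf (hf : f ∈ RHInfVec E) (θ : Freq) :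
    Gam α β κ (controllerOf α β κ f) θ = gamOf α β κ f θ := by
  rw [Gam_eq, ← det_loopMatrix, det_loopMatrix_controllerOf α β κ hf, inv_inv]

theorem Lam_controllerOf (hf : f ∈ RHInfVec E) (θ : Freq) :
    Lam α β κ (controllerOf α β κ f) θ = lamOf α β κ f θ := by
  have h := Gam_controllerOf α β κ hf θ
  rw [Gam_eq_charPoly_mul, gamOf] at h
  exact mul_left_cancel₀ (charPoly_ne_zero α β κ θ) h

theorem Ome_controllerOf (hf : f ∈ RHInfVec E) (θ : Freq) :
    Ome α β κ (controllerOf α β κ f) θ = gamOf α β κ f θ := by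
  rw [Ome_eq_charPoly_mul, Lam_controllerOf α β κ hf, gamOf]

theorem Psi_controllerOf (hf : f ∈ RHInfVec E) (θ : Freq) :
    Psi α β κ (controllerOf α β κ f) θ = psiOf α β κ f θ := by
  rw [Psi_eq_charPoly_mul α β κ (det_loopMatrix_controllerOf_ne_zero α β κ hf θ),
    Lam_controllerOf α β κ hf, psiOf]

theorem internallyStabilizing_controllerOf (hf : f ∈ RHInfVec E) :
    InternallyStabilizing α β κ (controllerOf α β κ f) := fun θ => by
  rw [Gam_controllerOf α β κ hf, Lam_controllerOf α β κ hf, Psi_controllerOf α β κ hf,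
    Ome_controllerOf α β κ hf]
  exact ⟨det_loopMatrix_controllerOf_ne_zero α β κ hf θ, isRHInf_gamOf α β κ hf θ,
    isRHInf_lamOf α β κ hf θ, isRHInf_psiOf α β κ hf θ, isRHInf_gamOf α β κ hf θ⟩

theorem parameter_controllerOf (hf : f ∈ RHInfVec E) (θ : Freq) :
    parameter α β κ (controllerOf α β κ f) θ = spatialTransform f θ := by
  have hX := RatFunc.X_ne_zero (K := ℂ)
  rw [parameter, Lam_controllerOf α β κ hf, lamOf]
  field_simp
  ring

end Loop

/-! ### Extents of the closed-loop maps and the parametrization of feasible controllers -/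

section Feasibility

variable (α β κ : ℝ)

theorem lamOf_eq_Lam {K : Controller} {E : ℕ} {f : Site E → RatFunc ℝ} {θ : Freq}
    (h : parameter α β κ K θ = spatialTransform f θ) :
    lamOf α β κ f θ = Lam α β κ K θ := by
  have hX := RatFunc.X_ne_zero (K := ℂ)
  rw [lamOf, ← h, parameter]
  field_simp
  ring

/-- The offset serves both λ (`c = β`) and `charPoly` (`c = 0`). -/
theorem hasExtent_sigma (c : ℝ) :
    HasExtent (fun θ => RatFunc.C ((sigma α κ θ + c : ℝ) : ℂ)) 1 := by
  refine ⟨fun k => tridiagonal (RatFunc.C (α + c)) (RatFunc.C (α * κ)) k, fun θ => ?_⟩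
  rw [spatialTransform_restrict, seqTransform_tridiagonal le_rfl, complexify_C, complexify_C,
    ← map_mul, ← map_add]
  simp only [sigma]
  push_cast
  ring_nf

theorem hasExtent_charPoly : HasExtent (charPoly α β κ) 1 := by
  have hX := hasExtent_complexify RatFunc.X
  have hb := (hX.mono zero_le_one).sub (hasExtent_sigma α κ 0)
  have h := hb.smul (RatFunc.X - RatFunc.C β)
  simp only [add_zero, map_sub, complexify_X, complexify_C] at h
  exact h

variable {α β κ}

theorem hasExtent_lamOf {E : ℕ} (f : Site E → RatFunc ℝ) :
    HasExtent (lamOf α β κ f) (max E 1) := by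
  have h2 := (hasExtent_complexify (RatFunc.X ^ 2)⁻¹).mono (Nat.zero_le (max E 1))
  have h3 := ((hasExtent_sigma α κ β).smul (RatFunc.X ^ 3)⁻¹).mono (le_max_right E 1)
  have hf : HasExtent (spatialTransform f) E := ⟨f, fun _ => rfl⟩
  have h4 := (hf.smul (RatFunc.X ^ 4)⁻¹).mono (le_max_left E 1)
  have h := (h2.add h3).add h4
  simp only [map_inv₀, map_pow, complexify_X] at h
  exact h

theorem hasExtent_gamOf {E : ℕ} (f : Site E → RatFunc ℝ) :
    HasExtent (gamOf α β κ f) (max (E + 1) 2) :=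
  ((hasExtent_charPoly α β κ).mul (hasExtent_lamOf f)).mono (by lia)

theorem hasExtent_psiOf {E : ℕ} (f : Site E → RatFunc ℝ) :
    HasExtent (psiOf α β κ f) (max (E + 2) 3) := by
  have hc := hasExtent_charPoly α β κ
  have hg := hasExtent_gamOf (α := α) (β := β) (κ := κ) f
  have h := ((hc.mul hg).mono (by lia : _ ≤ max (E + 2) 3)).sub
    (hc.mono (by lia))
  convert h using 2 with θ
  rw [psiOf, gamOf]
  ring

theorem controllerOf_mem_feasibleBounded {E : ℕ} {f : Site E → RatFunc ℝ}
    (hf : f ∈ RHInfVec E) : controllerOf α β κ f ∈ feasibleBounded α β κ E := by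
  refine ⟨internallyStabilizing_controllerOf α β κ hf, ?_⟩
  rw [funext (Gam_controllerOf α β κ hf), funext (Lam_controllerOf α β κ hf),
    funext (Psi_controllerOf α β κ hf), funext (Ome_controllerOf α β κ hf)]
  exact ⟨hasExtent_gamOf f, hasExtent_lamOf f, hasExtent_psiOf f, hasExtent_gamOf f⟩

theorem feasibleBounded_subset_feasible (E : ℕ) : feasibleBounded α β κ E ⊆ feasible α β κ :=
  fun _ h => ⟨h.1, ⟨_, h.2.1⟩, ⟨_, h.2.2.1⟩, ⟨_, h.2.2.2.1⟩, ⟨_, h.2.2.2.2⟩⟩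

theorem hasExtent_parameter {K : Controller} {E : ℕ} (h : HasExtent (Lam α β κ K) E) :
    HasExtent (parameter α β κ K) (max E 1) := by
  have h4 := (h.smul (RatFunc.X ^ 4)).mono (le_max_left E 1)
  have h2 := (hasExtent_complexify (RatFunc.X ^ 2)).mono (Nat.zero_le (max E 1))
  have h1 := ((hasExtent_sigma α κ β).smul RatFunc.X).mono (le_max_right E 1)
  have := (h4.sub h2).sub h1
  simp only [map_pow, complexify_X] at this
  exact this

/-- Only the extent of the parameter is assumed: `K` is recovered from Λ alone, and the extents of
the other maps then follow from those of λ, γ and ψ. -/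
theorem controllerOf_surjOn {K : Controller} {E : ℕ} (hK : InternallyStabilizing α β κ K)
    (hE : HasExtent (parameter α β κ K) E) : ∃ f ∈ RHInfVec E, controllerOf α β κ f = K := by
  obtain ⟨f, hf⟩ := hE
  refine ⟨f, isRHInf_of_spatialTransform fun θ => ?_, funext fun θ => ?_⟩
  · rw [← hf]
    exact isRHInf_parameter α β κ (hK θ).1 (hK θ).2.2.1 (hK θ).2.2.2.1
  · rw [controller_eq α β κ (hK θ).1, controllerOf, psiOf, gamOf, lamOf_eq_Lam α β κ (hf θ)]

theorem bijOn_controllerOf (E : ℕ) : Set.BijOn (controllerOf α β κ) (RHInfVec E)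
    {K ∈ feasible α β κ | HasExtent (parameter α β κ K) E} := by
  refine ⟨fun f hf => ?_, fun f hf g hg h => ?_, fun K hK => controllerOf_surjOn hK.1.1 hK.2⟩
  · exact ⟨feasibleBounded_subset_feasible E (controllerOf_mem_feasibleBounded hf),
      f, parameter_controllerOf α β κ hf⟩
  · refine spatialTransform_injective fun θ => ?_
    rw [← parameter_controllerOf α β κ hf, ← parameter_controllerOf α β κ hg, h]

/-- The σ term in λ costs extent 1. For `E ≥ 1` it is absorbed in both directions, whereas for `E =
0` the bound on Λ only yields a parameter of extent 1. -/
theorem setOf_parameter_eq_feasibleBounded {E : ℕ} (hE : 1 ≤ E) :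
    {K ∈ feasible α β κ | HasExtent (parameter α β κ K) E} = feasibleBounded α β κ E := by
  refine Set.Subset.antisymm (fun K hK => ?_) fun K hK =>
    ⟨feasibleBounded_subset_feasible E hK, ?_⟩
  · obtain ⟨f, hf, rfl⟩ := controllerOf_surjOn hK.1.1 hK.2
    exact controllerOf_mem_feasibleBounded hf
  · exact (hasExtent_parameter hK.2.2.1).mono (by lia)

theorem feasible_eq_iUnion :
    feasible α β κ = ⋃ E : ℕ, controllerOf α β κ '' RHInfVec E := by
  refine Set.Subset.antisymm (fun K hK => ?_) (Set.iUnion_subset fun E => ?_)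
  · obtain ⟨E, hE⟩ := hK.2.2.1
    exact Set.mem_iUnion.2 ⟨max E 1, controllerOf_surjOn hK.1 (hasExtent_parameter hE)⟩
  · rintro _ ⟨f, hf, rfl⟩
    exact feasibleBounded_subset_feasible E (controllerOf_mem_feasibleBounded hf)

end Feasibility

/-! ### The two `H₂` norms -/

theorem eval_spatialTransform {n : ℕ} {v : Site n → RatFunc ℝ}
    (hv : ∀ k, v k ∈ stableSubring ℝ) (θ : Freq) {z : ℂ} (hz : ‖z‖ = 1) :
    RatFunc.eval (RingHom.id ℂ) z (spatialTransform v θ) =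
      ∑ k : Site n, character k θ * RatFunc.eval (algebraMap ℝ ℂ) z (v k) := by
  have hv' (k : Site n) := complexify_mem_stableSubring.2 (hv k)
  rw [← Algebra.algebraMap_self, spatialTransform, eval_sum_of_mem _ _
    (fun k _ => mul_mem (C_mem_stableSubring _) (hv' k)) hz]
  refine Finset.sum_congr rfl fun k _ => ?_
  rw [eval_mul_of_mem (C_mem_stableSubring _) (hv' k) hz, eval_complexify (hv k) hz,
    RatFunc.eval_C]
  rfl

theorem lintegral_freq (F : ℝ → ENNReal) :
    ∫⁻ θ : Freq, F θ ∂(Measure.comap Subtype.val volume) =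
      ∫⁻ θ in Set.Ico (0 : ℝ) (2 * Real.pi), F θ :=
  lintegral_subtype_comap measurableSet_Ico F

/-- Tonelli exchanges θ and φ, and Parseval applies in θ at each fixed φ; its factor 2π turns 1/4π²
into 1/2π. The extent `N` may vary from entry to entry. -/
theorem h2NormSqFreq_eq {m n : Type*} [Fintype m] [Fintype n]
    (G : Freq → Matrix m n (RatFunc ℂ)) (S : m → n → ℝ → ENNReal)
    (h : ∀ i j, ∃ (N : ℕ) (v : Site N → RatFunc ℝ), (∀ k, v k ∈ stableSubring ℝ) ∧
      (∀ θ, spatialTransform v θ = G θ i j) ∧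
      ∀ φ, S i j φ = ∑ k, ‖RatFunc.eval (algebraMap ℝ ℂ) (circlePoint φ) (v k)‖ₑ ^ 2) :
    h2NormSqFreq G = ENNReal.ofReal (1 / (2 * Real.pi)) *
      ∫⁻ φ in Set.Ico (0 : ℝ) (2 * Real.pi), ∑ i, ∑ j, S i j φ := by
  choose N v hv hG hS using h
  have hcont (i : m) (j : n) : Continuous fun p : ℝ × ℝ => ∑ k : Site (N i j),
      character k p.1 * RatFunc.eval (algebraMap ℝ ℂ) (circlePoint p.2) (v i j k) :=
    continuous_finsetSum _ fun k _ => ((continuous_character _).comp continuous_fst).mul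
      ((continuous_eval_circlePoint (hv i j k)).comp continuous_snd)
  have hmeas (i : m) (j : n) : Measurable fun p : ℝ × ℝ => ‖∑ k : Site (N i j),
      character k p.1 * RatFunc.eval (algebraMap ℝ ℂ) (circlePoint p.2) (v i j k)‖ₑ ^ 2 :=
    (hcont i j).measurable.enorm.pow_const 2
  have hev (θ : Freq) (φ : ℝ) (i : m) (j : n) :
      ‖RatFunc.eval (RingHom.id ℂ) (Complex.exp (Complex.I * φ)) (G θ i j)‖ₑ ^ 2 =
        ‖∑ k : Site (N i j), character k θ *
          RatFunc.eval (algebraMap ℝ ℂ) (circlePoint φ) (v i j k)‖ₑ ^ 2 := by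
    rw [← hG, eval_spatialTransform (hv i j) θ (norm_circlePoint φ)]
  simp only [h2NormSqFreq, hev]
  rw [lintegral_freq fun θ => ∫⁻ φ in Set.Ico (0 : ℝ) (2 * Real.pi), ∑ i, ∑ j,
    ‖∑ k : Site (N i j), character k θ *
      RatFunc.eval (algebraMap ℝ ℂ) (circlePoint φ) (v i j k)‖ₑ ^ 2]
  rw [lintegral_lintegral_swap
    (Finset.measurable_sum _ fun i _ => Finset.measurable_sum _ fun j _ => hmeas i j).aemeasurable]
  have hin (φ : ℝ) : ∫⁻ θ in Set.Ico (0 : ℝ) (2 * Real.pi), ∑ i, ∑ j,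
      ‖∑ k : Site (N i j), character k θ *
        RatFunc.eval (algebraMap ℝ ℂ) (circlePoint φ) (v i j k)‖ₑ ^ 2 =
      ENNReal.ofReal (2 * Real.pi) * ∑ i, ∑ j, S i j φ := by
    have hm (i : m) (j : n) : Measurable fun θ : ℝ => ‖∑ k : Site (N i j), character k θ *
        RatFunc.eval (algebraMap ℝ ℂ) (circlePoint φ) (v i j k)‖ₑ ^ 2 :=
      (continuous_finsetSum _ fun k _ =>
        (continuous_character _).mul continuous_const).measurable.enorm.pow_const 2
    rw [lintegral_finsetSum _ fun i _ => Finset.measurable_sum _ fun j _ => hm i j,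
      Finset.mul_sum]
    refine Finset.sum_congr rfl fun i _ => ?_
    rw [lintegral_finsetSum _ fun j _ => hm i j, Finset.mul_sum]
    refine Finset.sum_congr rfl fun j _ => ?_
    rw [hS, ← lintegral_norm_sq_trigPolynomial]
  simp only [hin]
  rw [lintegral_const_mul' _ _ ENNReal.ofReal_ne_top, ← mul_assoc,
    ← ENNReal.ofReal_mul (by positivity)]
  congr 2
  have := Real.pi_ne_zero
  field_simp
  norm_num

/-- The squared norm of a column of stable transfer functions as a Bochner integral. -/
theorem h2NormSqIndex_eq_ofReal {m : Type*} [Fintype m] {v : m → RatFunc ℝ}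
    (hv : ∀ k, v k ∈ stableSubring ℝ) :
    h2NormSqIndex v = ENNReal.ofReal (1 / (2 * Real.pi) *
      ∫ φ in Set.Ico (0 : ℝ) (2 * Real.pi),
        ∑ k, ‖RatFunc.eval (algebraMap ℝ ℂ) (circlePoint φ) (v k)‖ ^ 2) := by
  have hc : Continuous fun φ : ℝ =>
      ∑ k, ‖RatFunc.eval (algebraMap ℝ ℂ) (circlePoint φ) (v k)‖ ^ 2 :=
    continuous_finsetSum _ fun k _ => (continuous_eval_circlePoint (hv k)).norm.pow 2
  rw [h2NormSqIndex, ENNReal.ofReal_mul (by positivity), ofReal_integral_eq_lintegral_ofReal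
    ((hc.integrableOn_Icc (a := 0) (b := 2 * Real.pi)).mono_set Set.Ico_subset_Icc_self)
    (Filter.Eventually.of_forall fun _ => by positivity)]
  congr 2
  funext φ
  rw [ENNReal.ofReal_sum_of_nonneg fun _ _ => by positivity]
  refine Finset.sum_congr rfl fun k _ => ?_
  rw [ENNReal.ofReal_pow (norm_nonneg _), ofReal_norm]

theorem toReal_h2NormSqIndex {m : Type*} [Fintype m] {v : m → RatFunc ℝ}
    (hv : ∀ k, v k ∈ stableSubring ℝ) :
    (h2NormSqIndex v).toReal = 1 / (2 * Real.pi) *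
      ∫ φ in Set.Ico (0 : ℝ) (2 * Real.pi),
        ∑ k, ‖RatFunc.eval (algebraMap ℝ ℂ) (circlePoint φ) (v k)‖ ^ 2 := by
  rw [h2NormSqIndex_eq_ofReal hv, ENNReal.toReal_ofReal]
  refine mul_nonneg (by positivity) (integral_nonneg fun _ => ?_)
  positivity

/-- Evaluation on the circle is linear on stable functions, and w ↦ |w|² is convex; integrate the
pointwise inequality. -/
theorem toReal_h2NormSqIndex_convex {m : Type*} [Fintype m] {v w : m → RatFunc ℝ}
    (hv : ∀ k, v k ∈ stableSubring ℝ) (hw : ∀ k, w k ∈ stableSubring ℝ) {a b : ℝ}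
    (ha : 0 ≤ a) (hb : 0 ≤ b) (hab : a + b = 1) :
    (h2NormSqIndex (a • v + b • w)).toReal ≤
      a * (h2NormSqIndex v).toReal + b * (h2NormSqIndex w).toReal := by
  have hsm (c : ℝ) {g : RatFunc ℝ} (hg : g ∈ stableSubring ℝ) : c • g ∈ stableSubring ℝ := by
    rw [RatFunc.smul_eq_C_mul]
    exact mul_mem (C_mem_stableSubring c) hg
  have hvw (k : m) : (a • v + b • w) k ∈ stableSubring ℝ :=
    add_mem (hsm a (hv k)) (hsm b (hw k))
  have hint {u : m → RatFunc ℝ} (hu : ∀ k, u k ∈ stableSubring ℝ) : IntegrableOn (fun φ : ℝ =>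
      ∑ k, ‖RatFunc.eval (algebraMap ℝ ℂ) (circlePoint φ) (u k)‖ ^ 2)
      (Set.Ico 0 (2 * Real.pi)) := by
    refine (Continuous.integrableOn_Icc ?_).mono_set Set.Ico_subset_Icc_self
    exact continuous_finsetSum _ fun k _ => (continuous_eval_circlePoint (hu k)).norm.pow 2
  have hsq : ConvexOn ℝ Set.univ fun x : ℂ => ‖x‖ ^ 2 :=
    (convexOn_norm convex_univ).pow (fun _ _ => norm_nonneg _) 2
  rw [toReal_h2NormSqIndex hvw, toReal_h2NormSqIndex hv, toReal_h2NormSqIndex hw,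
    mul_left_comm a, mul_left_comm b, ← mul_add, ← integral_const_mul a, ← integral_const_mul b,
    ← integral_add ((hint hv).const_mul a) ((hint hw).const_mul b)]
  refine mul_le_mul_of_nonneg_left (integral_mono (hint hvw)
    (((hint hv).const_mul a).add ((hint hw).const_mul b)) fun φ => ?_) (by positivity)
  simp only [Finset.mul_sum, ← Finset.sum_add_distrib, Pi.add_apply, Pi.smul_apply]
  refine Finset.sum_le_sum fun k _ => ?_
  have hz := norm_circlePoint φ
  rw [eval_add_of_mem (hsm a (hv k)) (hsm b (hw k)) hz, RatFunc.smul_eq_C_mul,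
    RatFunc.smul_eq_C_mul, eval_mul_of_mem (C_mem_stableSubring a) (hv k) hz,
    eval_mul_of_mem (C_mem_stableSubring b) (hw k) hz, RatFunc.eval_C, RatFunc.eval_C]
  have := hsq.2 (Set.mem_univ (RatFunc.eval (algebraMap ℝ ℂ) (circlePoint φ) (v k)))
    (Set.mem_univ (RatFunc.eval (algebraMap ℝ ℂ) (circlePoint φ) (w k))) ha hb hab
  simpa [Complex.real_smul] using this

/-! ### The blocks of the stacked column -/

section Blocks

variable (α β κ : ℝ) {E : ℕ} (f : Site E → RatFunc ℝ)

/-- The column of `λ(f)`. -/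
def lamCol : Site (E + 1) → RatFunc ℝ := (matS E).mulVec f + vecG α β κ E

/-- The column of `γ(f) - 1`. -/
def gamCol : Site (E + 2) → RatFunc ℝ := (matVGam α β κ E).mulVec (lamCol α β κ f) + vecHGam E

/-- The column of `ψ(f)`. -/
def psiCol : Site (E + 3) → RatFunc ℝ :=
  (matVPsi α β κ E).mulVec (lamCol α β κ f) + vecHPsi α β κ E

/-- The sum regroups as W(Sf + g) + h, and Sf + g is the column of λ. -/
theorem matVIO_mulVec_add_vecHIO : (matVIO α β κ E).mulVec f + vecHIO α β κ E =
    Sum.elim (gamCol α β κ f) (Sum.elim (lamCol α β κ f) (Sum.elim (zSub β • gamCol α β κ f)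
      (Sum.elim (zSub β • lamCol α β κ f) (Sum.elim (psiCol α β κ f) (gamCol α β κ f))))) := by
  have h : (matVIO α β κ E).mulVec f + vecHIO α β κ E =
      (matStack α β κ E).mulVec (lamCol α β κ f) + vecStack α β κ E := by
    rw [matVIO, vecHIO, lamCol, Matrix.mulVec_add, ← Matrix.mulVec_mulVec, add_assoc]
  rw [h, matStack, vecStack]
  simp only [Matrix.fromRows_mulVec, Matrix.one_mulVec, Matrix.smul_mulVec]
  ext (i | i | i | i | i | i) <;>
    simp only [Pi.add_apply, Sum.elim_inl, Sum.elim_inr, Pi.smul_apply, Pi.zero_apply, add_zero,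
      gamCol, psiCol, smul_add]

variable (θ : Freq)

theorem spatialTransform_lamCol :
    spatialTransform (lamCol α β κ f) θ = lamOf α β κ f θ := by
  -- `matS` pads by zero to the next extent and delays by four steps.
  have hS : (matS E).mulVec f =
      (RatFunc.X ^ 4 : RatFunc ℝ)⁻¹ • fun i : Site (E + 1) => extendZero f i := by
    funext i
    simp only [Matrix.mulVec, dotProduct, matS, Matrix.of_apply, Pi.smul_apply, smul_eq_mul,
      ite_mul, zero_mul]
    by_cases hi : (i : ℤ) ∈ Finset.Icc (-(E : ℤ)) E
    · rw [Finset.sum_eq_single ⟨i, hi⟩, if_pos rfl, extendZero, dif_pos hi]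
      · intro j _ hj
        exact if_neg fun h => hj (Subtype.ext h.symm)
      · simp
    · rw [extendZero, dif_neg hi, mul_zero]
      exact Finset.sum_eq_zero fun j _ => if_neg fun h : (i : ℤ) = j => hi (h ▸ j.2)
  have hG : vecG α β κ E = (RatFunc.X ^ 3 : RatFunc ℝ)⁻¹ • fun i : Site (E + 1) =>
      tridiagonal (RatFunc.X + RatFunc.C (α + β)) (RatFunc.C (α * κ)) i := rfl
  have hX := RatFunc.X_ne_zero (K := ℂ)
  rw [lamCol, hS, hG, spatialTransform_add, spatialTransform_smul, spatialTransform_smul,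
    spatialTransform_restrict, spatialTransform_restrict,
    seqTransform_of_le (Nat.le_succ E) fun _ => extendZero_eq_zero f,
    ← spatialTransform_eq_seqTransform, seqTransform_tridiagonal (Nat.le_add_left 1 E), lamOf,
    sigma]
  simp only [map_inv₀, map_pow, complexify_X, map_add, complexify_C, map_mul, Complex.ofReal_add,
    Complex.ofReal_mul, Complex.ofReal_one, Complex.ofReal_ofNat]
  field_simp
  simp only [map_one]
  ring

theorem complexify_zSub (c : ℝ) : complexify (zSub c) = RatFunc.X - RatFunc.C (c : ℂ) := by
  rw [zSub, map_sub, complexify_X, complexify_C]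

theorem spatialTransform_gamCol :
    spatialTransform (gamCol α β κ f) θ = gamOf α β κ f θ - 1 := by
  have hV : matVGam α β κ E = zSub β • Matrix.of fun (i : Site (E + 2)) (j : Site (E + 1)) =>
      tridiagonal (zSub α) (RatFunc.C (-(α * κ))) ((i : ℤ) - j) := rfl
  have hH : vecHGam E = fun i : Site (E + 2) => tridiagonal (-1) 0 i := by
    funext i
    simp [vecHGam, tridiagonal]
  rw [gamCol, hV, hH, Matrix.smul_mulVec, spatialTransform_add, spatialTransform_smul,
    spatialTransform_toeplitz (b := 1) le_rfl fun k => tridiagonal_eq_zero _ _ le_rfl k,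
    spatialTransform_lamCol, spatialTransform_restrict, seqTransform_tridiagonal le_rfl,
    seqTransform_tridiagonal (by lia), gamOf, charPoly, sigma]
  simp only [complexify_zSub, complexify_C, map_neg, map_mul, map_one, map_zero, map_add,
    Complex.ofReal_add, Complex.ofReal_mul, Complex.ofReal_one, Complex.ofReal_ofNat]
  ring

/-- The pentadiagonal entries are those of the square of the tridiagonal symbol (z - α) - ακ(2 cos
θ). The diagonal term 2(ακ)² offsets the -2 in (2 cos θ)² - 2. -/
theorem spatialTransform_psiCol :
    spatialTransform (psiCol α β κ f) θ = psiOf α β κ f θ := by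
  have hV : matVPsi α β κ E =
      zSub β ^ 2 • Matrix.of fun (i : Site (E + 3)) (j : Site (E + 1)) =>
        pentadiagonal (zSub α ^ 2 + RatFunc.C (2 * (α * κ) ^ 2))
          (RatFunc.C (-(2 * (α * κ))) * zSub α) (RatFunc.C ((α * κ) ^ 2)) ((i : ℤ) - j) := rfl
  have hH : vecHPsi α β κ E = zSub β • fun i : Site (E + 3) =>
      tridiagonal (-zSub α) (RatFunc.C (α * κ)) i := rfl
  rw [psiCol, hV, hH, Matrix.smul_mulVec, spatialTransform_add, spatialTransform_smul,
    spatialTransform_toeplitz (b := 2) le_rfl fun k => pentadiagonal_eq_zero _ _ _ k,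
    spatialTransform_lamCol, spatialTransform_smul, spatialTransform_restrict,
    seqTransform_tridiagonal (by lia), seqTransform_pentadiagonal, psiOf, charPoly, sigma]
  have h2 : RatFunc.C (2 : ℂ) = 2 := map_ofNat _ 2
  simp only [complexify_zSub, complexify_C, map_neg, map_mul, map_one, map_add, map_pow,
    Complex.ofReal_add, Complex.ofReal_mul, Complex.ofReal_one, Complex.ofReal_ofNat, h2]
  ring

end Blocks

/-! ### Cost and objective -/

section Objective

variable {α β κ : ℝ} {E : ℕ} {f : Site E → RatFunc ℝ}

theorem zSub_mem_stableSubring (c : ℝ) : zSub c ∈ stableSubring ℝ :=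
  sub_mem X_mem_stableSubring (C_mem_stableSubring c)

/-- Stability of the coefficients is pulled back from the frequency domain by Fourier inversion,
with no inspection of the matrices. -/
theorem lamCol_mem_stableSubring (hf : f ∈ RHInfVec E) (k : Site (E + 1)) :
    lamCol α β κ f k ∈ stableSubring ℝ :=
  mem_stableSubring_of_spatialTransform (fun θ => by
    rw [spatialTransform_lamCol]
    exact (isRHInf_lamOf α β κ hf θ).mem) k

theorem gamCol_mem_stableSubring (hf : f ∈ RHInfVec E) (k : Site (E + 2)) :
    gamCol α β κ f k ∈ stableSubring ℝ :=
  mem_stableSubring_of_spatialTransform (fun θ => by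
    rw [spatialTransform_gamCol]
    exact sub_mem (isRHInf_gamOf α β κ hf θ).mem (one_mem _)) k

theorem psiCol_mem_stableSubring (hf : f ∈ RHInfVec E) (k : Site (E + 3)) :
    psiCol α β κ f k ∈ stableSubring ℝ :=
  mem_stableSubring_of_spatialTransform (fun θ => by
    rw [spatialTransform_psiCol]
    exact (isRHInf_psiOf α β κ hf θ).mem) k

theorem stack_mem_stableSubring (hf : f ∈ RHInfVec E) (k : Rows E) :
    ((matVIO α β κ E).mulVec f + vecHIO α β κ E) k ∈ stableSubring ℝ := by
  rw [matVIO_mulVec_add_vecHIO]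
  rcases k with k | k | k | k | k | k
  · exact gamCol_mem_stableSubring hf k
  · exact lamCol_mem_stableSubring hf k
  · exact mul_mem (zSub_mem_stableSubring β) (gamCol_mem_stableSubring hf k)
  · exact mul_mem (zSub_mem_stableSubring β) (lamCol_mem_stableSubring hf k)
  · exact psiCol_mem_stableSubring hf k
  · exact gamCol_mem_stableSubring hf k

theorem objective_ne_top (hf : f ∈ RHInfVec E) : objective α β κ E f ≠ ⊤ := by
  rw [objective, h2NormSqIndex_eq_ofReal (stack_mem_stableSubring hf)]
  exact ENNReal.ofReal_ne_top

theorem closedLoop_controllerOf (hf : f ∈ RHInfVec E) (θ : Freq) :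
    closedLoop α β κ (controllerOf α β κ f) θ =
      !![spatialTransform (gamCol α β κ f) θ, spatialTransform (lamCol α β κ f) θ;
        spatialTransform (zSub β • gamCol α β κ f) θ,
          spatialTransform (zSub β • lamCol α β κ f) θ;
        spatialTransform (psiCol α β κ f) θ, spatialTransform (gamCol α β κ f) θ] := by
  rw [closedLoop_eq α β κ (det_loopMatrix_controllerOf_ne_zero α β κ hf θ),
    Gam_controllerOf α β κ hf, Lam_controllerOf α β κ hf, Psi_controllerOf α β κ hf,
    Ome_controllerOf α β κ hf, spatialTransform_smul, spatialTransform_smul,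
    spatialTransform_gamCol, spatialTransform_lamCol, spatialTransform_psiCol, complexify_zSub]

theorem h2NormSqFreq_controllerOf (hf : f ∈ RHInfVec E) :
    h2NormSqFreq (closedLoop α β κ (controllerOf α β κ f)) = objective α β κ E f := by
  let s {n : ℕ} (v : Site n → RatFunc ℝ) (φ : ℝ) : ENNReal :=
    ∑ k, ‖RatFunc.eval (algebraMap ℝ ℂ) (circlePoint φ) (v k)‖ₑ ^ 2
  have hg := gamCol_mem_stableSubring (α := α) (β := β) (κ := κ) hf
  have hl := lamCol_mem_stableSubring (α := α) (β := β) (κ := κ) hf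
  have hz := zSub_mem_stableSubring β
  -- Reading the 3 × 2 closed loop row by row gives the order of `Rows`; γ - 1 occurs twice because
  -- Γ = Ω.
  rw [h2NormSqFreq_eq _ (![![s (gamCol α β κ f), s (lamCol α β κ f)],
    ![s (zSub β • gamCol α β κ f), s (zSub β • lamCol α β κ f)],
    ![s (psiCol α β κ f), s (gamCol α β κ f)]]), objective, h2NormSqIndex,
    matVIO_mulVec_add_vecHIO]
  · congr 2
    funext φ
    simp only [Fin.sum_univ_succ, Fintype.sum_sum_type, Sum.elim_inl, Sum.elim_inr]
    simp [s, add_assoc]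
  · intro i j
    simp only [closedLoop_controllerOf hf]
    fin_cases i <;> fin_cases j
    · exact ⟨_, gamCol α β κ f, hg, fun _ => rfl, fun _ => rfl⟩
    · exact ⟨_, lamCol α β κ f, hl, fun _ => rfl, fun _ => rfl⟩
    · exact ⟨_, zSub β • gamCol α β κ f, fun k => mul_mem hz (hg k), fun _ => rfl, fun _ => rfl⟩
    · exact ⟨_, zSub β • lamCol α β κ f, fun k => mul_mem hz (hl k), fun _ => rfl, fun _ => rfl⟩
    · exact ⟨_, psiCol α β κ f, psiCol_mem_stableSubring hf, fun _ => rfl, fun _ => rfl⟩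
    · exact ⟨_, gamCol α β κ f, hg, fun _ => rfl, fun _ => rfl⟩

theorem cost_controllerOf_sq (hf : f ∈ RHInfVec E) :
    cost α β κ (controllerOf α β κ f) ^ 2 = objective α β κ E f := by
  rw [cost, h2NormSqFreq_controllerOf hf, ← ENNReal.rpow_natCast, ← ENNReal.rpow_mul]
  norm_num

theorem convexOn_objective (α β κ : ℝ) (E : ℕ) :
    ConvexOn ℝ (RHInfVec E) fun f => (objective α β κ E f).toReal := by
  refine ⟨fun f hf g hg a b _ _ _ k => ?_, fun f hf g hg a b ha hb hab => ?_⟩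
  · rw [Pi.add_apply, Pi.smul_apply, Pi.smul_apply, RatFunc.smul_eq_C_mul,
      RatFunc.smul_eq_C_mul]
    exact ((hf k).C_mul a).add ((hg k).C_mul b)
  · have h := toReal_h2NormSqIndex_convex (stack_mem_stableSubring (α := α) (β := β) (κ := κ) hf)
      (stack_mem_stableSubring (α := α) (β := β) (κ := κ) hg) ha hb hab
    have hlin : (matVIO α β κ E).mulVec (a • f + b • g) + vecHIO α β κ E =
        a • ((matVIO α β κ E).mulVec f + vecHIO α β κ E) +
          b • ((matVIO α β κ E).mulVec g + vecHIO α β κ E) := by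
      -- The objective's argument is affine, not linear; `a + b = 1` splits the constant part.
      have hv : vecHIO α β κ E = a • vecHIO α β κ E + b • vecHIO α β κ E := by
        rw [← add_smul, hab, one_smul]
      rw [Matrix.mulVec_add, Matrix.mulVec_smul, Matrix.mulVec_smul, smul_add, smul_add]
      nth_rewrite 1 [hv]
      abel
    rw [← hlin] at h
    exact h

/-- Squaring is an order isomorphism of [0, ∞], so it commutes with every infimum, attained or not.
-/
theorem iInf_cost_sq (s : Set Controller) :
    (⨅ K ∈ s, cost α β κ K) ^ 2 = ⨅ K ∈ s, cost α β κ K ^ 2 := by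
  have h : ∀ x : ENNReal, x ^ 2 = ENNReal.orderIsoRpow 2 two_pos x := fun x => by simp
  simp only [h, OrderIso.map_iInf]

theorem iInf_image_controllerOf (E : ℕ) :
    ⨅ K ∈ controllerOf α β κ '' RHInfVec E, cost α β κ K ^ 2 =
      ⨅ f ∈ RHInfVec E, objective α β κ E f := by
  rw [iInf_image]
  exact iInf_congr fun f => iInf_congr fun hf => cost_controllerOf_sq hf

theorem isMinOn_cost_iff (hf : f ∈ RHInfVec E) :
    IsMinOn (cost α β κ) {K ∈ feasible α β κ | HasExtent (parameter α β κ K) E}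
      (controllerOf α β κ f) ↔ IsMinOn (objective α β κ E) (RHInfVec E) f := by
  rw [← (bijOn_controllerOf E).image_eq, isMinOn_iff, isMinOn_iff, Set.forall_mem_image]
  refine forall₂_congr fun g hg => ?_
  rw [← cost_controllerOf_sq hf, ← cost_controllerOf_sq hg,
    ENNReal.pow_le_pow_left_iff two_ne_zero]

end Objective

end

end IOSynthesis

open IOSynthesis in
theorem mainTheorem2 (α β κ : ℝ) :
    -- the map from `(wʸ, wᵘ)` to `(x¹, x², u)` in terms of the closed-loop maps
    (∀ K, InternallyStabilizing α β κ K → ∀ θ,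
      closedLoop α β κ K θ =
        !![Gam α β κ K θ - 1, Lam α β κ K θ;
          (RatFunc.X - RatFunc.C (β : ℂ)) * (Gam α β κ K θ - 1),
            (RatFunc.X - RatFunc.C (β : ℂ)) * Lam α β κ K θ;
          Psi α β κ K θ, Ome α β κ K θ - 1]) ∧
    -- the problem with prescribed parameter extent `E`
    (∀ E : ℕ,
      Fintype.card (Site E) = 2 * E + 1 ∧
      Set.BijOn (controllerOf α β κ) (RHInfVec E)
        {K ∈ feasible α β κ | HasExtent (parameter α β κ K) E} ∧
      (∀ f ∈ RHInfVec E,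
        controllerOf α β κ f ∈ feasibleBounded α β κ E ∧
        Lam α β κ (controllerOf α β κ f) = lamOf α β κ f ∧
        objective α β κ E f ≠ ⊤ ∧
        cost α β κ (controllerOf α β κ f) ^ 2 = objective α β κ E f) ∧
      (1 ≤ E → {K ∈ feasible α β κ | HasExtent (parameter α β κ K) E} =
        feasibleBounded α β κ E) ∧
      (⨅ K ∈ {K ∈ feasible α β κ | HasExtent (parameter α β κ K) E}, cost α β κ K) ^ 2 =
        (⨅ f ∈ RHInfVec E, objective α β κ E f) ∧
      (∀ f ∈ RHInfVec E,
        IsMinOn (cost α β κ) {K ∈ feasible α β κ | HasExtent (parameter α β κ K) E}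
          (controllerOf α β κ f) ↔ IsMinOn (objective α β κ E) (RHInfVec E) f) ∧
      ConvexOn ℝ (RHInfVec E) fun f => (objective α β κ E f).toReal) ∧
    -- the problem with finite, not prescribed, extent
    feasible α β κ = (⋃ E : ℕ, controllerOf α β κ '' RHInfVec E) ∧
    (⨅ K ∈ feasible α β κ, cost α β κ K) ^ 2 =
      ⨅ E : ℕ, ⨅ f ∈ RHInfVec E, objective α β κ E f := by
  refine ⟨fun K hK θ => closedLoop_eq α β κ (hK θ).1, fun E => ⟨?_, bijOn_controllerOf E,
    fun f hf => ⟨controllerOf_mem_feasibleBounded hf, funext (Lam_controllerOf α β κ hf),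
      objective_ne_top hf, cost_controllerOf_sq hf⟩, setOf_parameter_eq_feasibleBounded, ?_,
    fun f hf => isMinOn_cost_iff hf, convexOn_objective α β κ E⟩, feasible_eq_iUnion, ?_⟩
  · rw [Fintype.card_coe, Int.card_Icc]
    lia
  · rw [iInf_cost_sq, ← (bijOn_controllerOf E).image_eq, iInf_image_controllerOf]
  · rw [iInf_cost_sq, feasible_eq_iUnion, iInf_iUnion]
    exact iInf_congr iInf_image_controllerOf
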